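/- Let $d,k\in\mathbb N$ with $1\le k$ and $2k<d$, let $\sigma,T>0$, let $\delta\in\mathbb R^d$, $\delta\neq 0$, and $r=\|\delta\|_2$. Put $\sigma'=\sqrt{d/(d-2k)}\,\sigma$. Let $\mathcal P=\mathcal N^{\mathsf g}(k,\sigma)$ be the probability distribution on $\mathbb R^d$ with density $p(x)\propto\|x\|_2^{-2k}\exp(-\|x\|_2^2/(2\sigma'^2))$ and let $\mathcal Q=\mathcal N^{\mathsf g}_{\mathsf{trunc}}(k,T,\sigma)$ be the one with density $q(x)\propto\|x\|_2^{-2k}\exp(-\|x\|_2^2/(2\sigma'^2))\,\mathbf 1[\|x\|_2\le T]$. For $\lambda_1,\lambda_2\in\mathbb R$ let $$R(\lambda_1,\lambda_2)=\Pr_{\varepsilon\sim\mathcal P}[p(\varepsilon)<\lambda_1p(\varepsilon+\delta)+\lambda_2q(\varepsilon+\delta)],$$ $$P(\lambda_1,\lambda_2)=\Pr_{\varepsilon\sim\mathcal P}[p(\varepsilon-\delta)<\lambda_1p(\varepsilon)+\lambda_2q(\varepsilon)],\qquad Q(\lambda_1,\lambda_2)=\Pr_{\varepsilon\sim\mathcal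 Q}[p(\varepsilon-\delta)<\lambda_1p(\varepsilon)+\lambda_2q(\varepsilon)].$$ Let $\Gamma(d/2-k,1)$ be the gamma distribution with shape $d/2-k$ and scale $1$, let $\nu=1/\Pr_{t\sim\Gamma(d/2-k,1)}[t\le T^2/(2\sigma'^2)]$, let $B$ be the CDF of $\mathrm{Beta}(\frac{d-1}2,\frac{d-1}2)$, and let $W$ be the principal branch of the Lambert $W$ function. Write $s_t=\sigma'\sqrt{2t}$. Then $$R(\lambda_1,\lambda_2)=\begin{cases}\mathbb E_{t\sim\Gamma(d/2-k,1)}\,u_1(t),&\lambda_1\le 0,\\ \mathbb E_{t\sim\Gamma(d/2-k,1)}\,[u_1(t)+u_2(t)],&\lambda_1>0,\end{cases}$$ $$P(\lambda_1,\lambda_2)=\mathbb E_{t\sim\Gamma(d/2-k,1)}\begin{cases}u_3(t,\lambda_1),&t\ge T^2/(2\sigma'^2),\\ u_3(t,\lambda_1+\nu\lambda_2),&t<T^2/(2\sigma'^2),\end{cases}$$ $$Q(\lambda_1,\lambda_2)=\nu\,\mathbb E_{t\sim\Gamma(d/2-k,1)}\,u_3(t,\lambda_1+\nu\lambda_2)\,\mathbf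 1[t\le T^2/(2\sigma'^2)],$$ where all the expectations are of integrable functions and $$u_1(t)=B\!\left(\frac{\min\{T^2,\,2\sigma'^2k\,W(\frac tk e^{t/k}(\lambda_1+\nu\lambda_2)^{1/k})\}-(s_t-r)^2}{4r\,s_t}\right)\ \text{ if }\lambda_1+\nu\lambda_2>0,\qquad u_1(t)=0\ \text{ otherwise},$$ $$u_2(t)=\max\left\{B\!\left(\frac{2\sigma'^2k\,W(\frac tk e^{t/k}\lambda_1^{1/k})-(s_t-r)^2}{4r\,s_t}\right)-B\!\left(\frac{T^2-(s_t-r)^2}{4r\,s_t}\right),\,0\right\}\ \text{ for }\lambda_1>0,$$ $$u_3(t,\lambda)=B\!\left(\frac{(r+s_t)^2-2k\sigma'^2\,W(\frac tk e^{t/k}\lambda^{-1/k})}{4r\,s_t}\right)\ \text{ if }\lambda>0,\qquad u_3(t,\lambda)=0\ \text{ if }\lambda\le 0.$$ -/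

import Mathlib

open MeasureTheory ProbabilityTheory

namespace DSRS

noncomputable section

/-! ### Special functions -/

/-- The principal branch of the (real) Lambert `W` function: for `x ≥ -1/e`, `lambertW x` is the
unique `w ≥ -1` with `w * exp w = x`. -/
def lambertW (x : ℝ) : ℝ :=
  Function.invFunOn (fun w : ℝ => w * Real.exp w) (Set.Ici (-1)) x

/-- The gamma distribution `Γ(d/2 - k, 1)` (shape `d/2 - k`, scale `1`). -/
def gammaLaw (d k : ℕ) : Measure ℝ := gammaMeasure ((d : ℝ) / 2 - k) 1

/-- The CDF of the distribution `Beta(a, a)`. -/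
def betaCDF (a x : ℝ) : ℝ := cdf (betaMeasure a a) x

/-! ### The smoothing distributions -/

/-- `σ' = √(d / (d - 2k)) σ`. -/
def sigma' (d k : ℕ) (σ : ℝ) : ℝ := √((d : ℝ) / ((d : ℝ) - 2 * k)) * σ

/-- The unnormalized density `‖x‖^(-2k) exp(-‖x‖² / (2σ'²))`. -/
def genGaussianWeight (d k : ℕ) (σ : ℝ) (x : EuclideanSpace ℝ (Fin d)) : ℝ :=
  (‖x‖ ^ (2 * k))⁻¹ * Real.exp (-‖x‖ ^ 2 / (2 * sigma' d k σ ^ 2))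

/-- The density of the generalized Gaussian `𝒩ᵍ(k, σ)` on `ℝᵈ`. -/
def genGaussianDensity (d k : ℕ) (σ : ℝ) (x : EuclideanSpace ℝ (Fin d)) : ℝ :=
  genGaussianWeight d k σ x / ∫ y, genGaussianWeight d k σ y

/-- The unnormalized density `‖x‖^(-2k) exp(-‖x‖² / (2σ'²)) 1[‖x‖ ≤ T]`. -/
def truncGenGaussianWeight (d k : ℕ) (T σ : ℝ) (x : EuclideanSpace ℝ (Fin d)) : ℝ :=
  if ‖x‖ ≤ T then genGaussianWeight d k σ x else 0

/-- The density of the truncated generalized Gaussian `𝒩ᵍ_trunc(k, T, σ)` on `ℝᵈ`. -/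
def truncGenGaussianDensity (d k : ℕ) (T σ : ℝ) (x : EuclideanSpace ℝ (Fin d)) : ℝ :=
  truncGenGaussianWeight d k T σ x / ∫ y, truncGenGaussianWeight d k T σ y

/-- The measure on `ℝᵈ` with the density `f` with respect to the Lebesgue measure. -/
def lawOfDensity {d : ℕ} (f : EuclideanSpace ℝ (Fin d) → ℝ) :
    Measure (EuclideanSpace ℝ (Fin d)) :=
  volume.withDensity fun x => ENNReal.ofReal (f x)

/-! ### The objective and the constraint functions of the dual problem -/

/-- `Pr_{ε ∼ μ} [p(ε) < λ₁ p(ε + δ) + λ₂ q(ε + δ)]`. -/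
def dualObjective {d : ℕ} (μ : Measure (EuclideanSpace ℝ (Fin d)))
    (p q : EuclideanSpace ℝ (Fin d) → ℝ) (δ : EuclideanSpace ℝ (Fin d)) (l₁ l₂ : ℝ) : ℝ :=
  μ.real {x | p x < l₁ * p (x + δ) + l₂ * q (x + δ)}

/-- `Pr_{ε ∼ μ} [p(ε - δ) < λ₁ p(ε) + λ₂ q(ε)]`. -/
def dualConstraint {d : ℕ} (μ : Measure (EuclideanSpace ℝ (Fin d)))
    (p q : EuclideanSpace ℝ (Fin d) → ℝ) (δ : EuclideanSpace ℝ (Fin d)) (l₁ l₂ : ℝ) : ℝ :=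
  μ.real {x | p (x - δ) < l₁ * p x + l₂ * q x}

/-- `R(λ₁, λ₂)` for `𝒫 = 𝒩ᵍ(k, σ)` and `𝒬 = 𝒩ᵍ_trunc(k, T, σ)`. -/
def R (d k : ℕ) (T σ : ℝ) (δ : EuclideanSpace ℝ (Fin d)) (l₁ l₂ : ℝ) : ℝ :=
  dualObjective (lawOfDensity (genGaussianDensity d k σ))
    (genGaussianDensity d k σ) (truncGenGaussianDensity d k T σ) δ l₁ l₂

/-- `P(λ₁, λ₂)` for `𝒫 = 𝒩ᵍ(k, σ)` and `𝒬 = 𝒩ᵍ_trunc(k, T, σ)`. -/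
def P (d k : ℕ) (T σ : ℝ) (δ : EuclideanSpace ℝ (Fin d)) (l₁ l₂ : ℝ) : ℝ :=
  dualConstraint (lawOfDensity (genGaussianDensity d k σ))
    (genGaussianDensity d k σ) (truncGenGaussianDensity d k T σ) δ l₁ l₂

/-- `Q(λ₁, λ₂)` for `𝒫 = 𝒩ᵍ(k, σ)` and `𝒬 = 𝒩ᵍ_trunc(k, T, σ)`. -/
def Q (d k : ℕ) (T σ : ℝ) (δ : EuclideanSpace ℝ (Fin d)) (l₁ l₂ : ℝ) : ℝ :=
  dualConstraint (lawOfDensity (truncGenGaussianDensity d k T σ))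
    (genGaussianDensity d k σ) (truncGenGaussianDensity d k T σ) δ l₁ l₂

/-! ### The one-dimensional expressions -/

/-- `ν`, the inverse of the value at `T² / (2σ'²)` of the CDF of `Γ(d/2 - k, 1)`. -/
def nu (d k : ℕ) (T σ : ℝ) : ℝ :=
  (cdf (gammaLaw d k) (T ^ 2 / (2 * sigma' d k σ ^ 2)))⁻¹

/-- The radius `σ' √(2t)`. -/
def rad (d k : ℕ) (σ t : ℝ) : ℝ := sigma' d k σ * √(2 * t)

/-- `2 σ'² k W((t/k) e^{t/k} c)`. -/
def lambertTerm (d k : ℕ) (σ t c : ℝ) : ℝ :=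
  2 * sigma' d k σ ^ 2 * k * lambertW (t / k * Real.exp (t / k) * c)

/-- `u₁(t)`; it is `0` when `λ₁ + ν λ₂ ≤ 0`. -/
def u₁ (d k : ℕ) (T σ r l₁ l₂ t : ℝ) : ℝ :=
  if 0 < l₁ + nu d k T σ * l₂ then
    betaCDF (((d : ℝ) - 1) / 2)
      (min (T ^ 2) (lambertTerm d k σ t ((l₁ + nu d k T σ * l₂) ^ (1 / (k : ℝ))))
          / (4 * r * rad d k σ t)
        - (rad d k σ t - r) ^ 2 / (4 * r * rad d k σ t))
  else 0

/-- `u₂(t)`, used for `λ₁ > 0` only. -/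
def u₂ (d k : ℕ) (T σ r l₁ t : ℝ) : ℝ :=
  max
    (betaCDF (((d : ℝ) - 1) / 2)
        ((lambertTerm d k σ t (l₁ ^ (1 / (k : ℝ))) - (rad d k σ t - r) ^ 2)
          / (4 * r * rad d k σ t))
      - betaCDF (((d : ℝ) - 1) / 2)
        ((T ^ 2 - (rad d k σ t - r) ^ 2) / (4 * r * rad d k σ t)))
    0

/-- `u₃(t, λ)`; it is `0` when `λ ≤ 0`. -/
def u₃ (d k : ℕ) (σ r t l : ℝ) : ℝ :=
  if 0 < l then
    betaCDF (((d : ℝ) - 1) / 2)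
      ((r + rad d k σ t) ^ 2 / (4 * r * rad d k σ t)
        - lambertTerm d k σ t (l ^ (-1 / (k : ℝ))) / (4 * r * rad d k σ t))
  else 0

/-- The integrand of the expression for `P(λ₁, λ₂)`. -/
def integrandP (d k : ℕ) (T σ r l₁ l₂ t : ℝ) : ℝ :=
  if T ^ 2 / (2 * sigma' d k σ ^ 2) ≤ t then u₃ d k σ r t l₁
  else u₃ d k σ r t (l₁ + nu d k T σ * l₂)

/-- The integrand of the expression for `Q(λ₁, λ₂)`. -/
def integrandQ (d k : ℕ) (T σ r l₁ l₂ t : ℝ) : ℝ :=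
  if t ≤ T ^ 2 / (2 * sigma' d k σ ^ 2) then u₃ d k σ r t (l₁ + nu d k T σ * l₂) else 0

end

end DSRS

namespace DSRS

open Set

/-! ### Spherical and cylindrical coordinates for the Lebesgue integral -/

/-! Write `δ = r • e` with `‖e‖ = 1`. Every event involved depends on `x` only through `‖x‖` and
`⟪e, x⟫`. Since the weight is radial, norm and direction are independent under it: `‖x‖ = σ'√(2t)`
with `t` gamma distributed, and `⟪e, x⟫ = ‖x‖ (2b - 1)` with `b ∼ Beta((d-1)/2, (d-1)/2)`. This is
`exists_lintegral_genGaussianWeight_mul`, obtained from cylindrical coordinates around `e`, polar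
coordinates in the half plane and two substitutions. Each probability is thus an average over `t` of
a Beta probability.

The ball of radius `T` has mass `1/ν`, so `q = ν p` there and `q = 0` outside
(`truncGenGaussianDensity_eq`). Each event then compares the radial weight at two points, with
coefficient `λ₁ + ν λ₂` or `λ₁`. In the variable `v = s² / (2σ'²k)` the weight is a constant times
`(v e^v)^(-k)` (`radialWeight_sq_eq`); taking `k`-th roots and inverting `v e^v` by `W` bounds the
squared norm of the shifted point.

Given `t` and `s = σ'√(2t)`, that squared norm is affine in `b`: `(s - r)² + 4rsb` for `x + δ` and
`(s + r)² - 4rsb` for `x - δ`. The bounds become thresholds for `b`, so conditional probabilities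
are values of the Beta CDF. For `R` the truncation acts on the shifted point, hence also on `b`,
which produces the minimum in `u₁` and the separate interval in `u₂`; for `P` and `Q` it depends on
`t` alone. -/

theorem lintegral_fun_norm_addHaar {E : Type*} [NormedAddCommGroup E] [NormedSpace ℝ E]
    [Nontrivial E] [MeasurableSpace E] [BorelSpace E] [FiniteDimensional ℝ E]
    (μ : Measure E) [μ.IsAddHaarMeasure] {f : ℝ → ENNReal} (hf : Measurable f) :
    ∫⁻ x, f ‖x‖ ∂μ = μ.toSphere univ *
      ∫⁻ y in Ioi (0 : ℝ), ENNReal.ofReal (y ^ (Module.finrank ℝ E - 1)) * f y :=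
  calc
    ∫⁻ x, f ‖x‖ ∂μ = ∫⁻ x : ({(0)}ᶜ : Set E), f ‖x.1‖ ∂(μ.comap (↑)) := by
      rw [lintegral_subtype_comap (measurableSet_singleton _).compl fun x ↦ f ‖x‖,
        restrict_compl_singleton]
    -- The integrand ignores the sphere factor, which therefore contributes only its total mass.
    _ = ∫⁻ x, f x.2 ∂μ.toSphere.prod (.volumeIoiPow (Module.finrank ℝ E - 1)) := by
      simpa using μ.measurePreserving_homeomorphUnitSphereProd.lintegral_comp_emb
        (Homeomorph.measurableEmbedding _) (f ∘ Subtype.val ∘ Prod.snd)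
    _ = μ.toSphere univ *
        ∫⁻ x : Ioi (0 : ℝ), f x ∂.volumeIoiPow (Module.finrank ℝ E - 1) := by
      have hm : Measurable fun x : Ioi (0 : ℝ) => f x := hf.comp measurable_subtype_coe
      rw [lintegral_prod _ (by fun_prop)]
      simp [mul_comm]
    _ = _ := by
      have hm : Measurable fun x : Ioi (0 : ℝ) => f x := hf.comp measurable_subtype_coe
      rw [Measure.volumeIoiPow, lintegral_withDensity_eq_lintegral_mul _ (by fun_prop) hm]
      simp only [Pi.mul_apply]
      rw [lintegral_subtype_comap measurableSet_Ioi fun a : ℝ ↦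
        ENNReal.ofReal (a ^ (Module.finrank ℝ E - 1)) * f a]

/-- Integration in cylindrical coordinates along a unit vector `e`. -/
theorem lintegral_norm_inner_eq_cylindrical {n : ℕ} (hn : 1 ≤ n)
    (e : EuclideanSpace ℝ (Fin (n + 1))) (he : ‖e‖ = 1) {F : ℝ × ℝ → ENNReal}
    (hF : Measurable F) :
    ∫⁻ x : EuclideanSpace ℝ (Fin (n + 1)), F (‖x‖, inner ℝ e x) =
      (volume : Measure (EuclideanSpace ℝ (Fin n))).toSphere univ *
        ∫⁻ a : ℝ, ∫⁻ y in Ioi (0 : ℝ),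
          ENNReal.ofReal (y ^ (n - 1)) * F (√(a ^ 2 + y ^ 2), a) := by
  -- An orthonormal basis with `b 0 = e` turns the coordinate along `e` into coordinate `0`; the
  -- constant family is only used on `{0}`.
  obtain ⟨b, hb⟩ := Orthonormal.exists_orthonormalBasis_extension_of_card_eq (𝕜 := ℝ)
    (E := EuclideanSpace ℝ (Fin (n + 1))) (ι := Fin (n + 1)) (by simp)
    (v := fun _ => e) (s := {0}) (by
      rw [orthonormal_iff_ite]
      rintro ⟨i, rfl⟩ ⟨j, rfl⟩
      simp [he])
  have hb0 : b 0 = e := hb 0 rfl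
  have h0 : ∀ x : EuclideanSpace ℝ (Fin (n + 1)), inner ℝ e x = b.repr x 0 := by
    intro x; rw [b.repr_apply_apply, hb0]
  have hmeas : Measurable fun z : ℝ × (Fin n → ℝ) =>
      F (√(z.1 ^ 2 + ‖WithLp.toLp 2 z.2‖ ^ 2), z.1) := by
    have : Measurable fun z : ℝ × (Fin n → ℝ) => ‖WithLp.toLp 2 z.2‖ :=
      ((PiLp.volume_preserving_toLp (Fin n)).measurable.comp measurable_snd).norm
    fun_prop
  have : Nontrivial (EuclideanSpace ℝ (Fin n)) := by
    have : Nonempty (Fin n) := ⟨⟨0, hn⟩⟩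
    infer_instance
  calc
    _ = ∫⁻ x : EuclideanSpace ℝ (Fin (n + 1)), F (‖b.repr x‖, b.repr x 0) := by
      simp_rw [h0, LinearIsometryEquiv.norm_map]
    _ = ∫⁻ x : EuclideanSpace ℝ (Fin (n + 1)), F (‖x‖, x 0) :=
      (b.measurePreserving_repr).lintegral_comp_emb
        b.repr.toHomeomorph.measurableEmbedding (fun x => F (‖x‖, x 0))
    _ = ∫⁻ x : Fin (n + 1) → ℝ, F (‖WithLp.toLp 2 x‖, x 0) :=
      ((PiLp.volume_preserving_toLp (Fin (n + 1))).lintegral_comp_emb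
        (MeasurableEquiv.toLp 2 _).measurableEmbedding (fun x => F (‖x‖, x 0))).symm
    _ = ∫⁻ z : ℝ × (Fin n → ℝ), F (√(z.1 ^ 2 + ‖WithLp.toLp 2 z.2‖ ^ 2), z.1) := by
      rw [← (volume_preserving_piFinSuccAbove (fun _ : Fin (n + 1) => ℝ) 0).lintegral_comp_emb
        (MeasurableEquiv.measurableEmbedding _)]
      refine lintegral_congr fun x => ?_
      congr 2
      rw [EuclideanSpace.norm_eq, EuclideanSpace.norm_sq_eq, Fin.sum_univ_succ]
      simp [Fin.tail]
    _ = ∫⁻ a : ℝ, ∫⁻ y : Fin n → ℝ, F (√(a ^ 2 + ‖WithLp.toLp 2 y‖ ^ 2), a) := by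
      rw [Measure.volume_eq_prod, lintegral_prod _ hmeas.aemeasurable]
    _ = ∫⁻ a : ℝ, ∫⁻ y : EuclideanSpace ℝ (Fin n), F (√(a ^ 2 + ‖y‖ ^ 2), a) := by
      refine lintegral_congr fun a => ?_
      exact (PiLp.volume_preserving_toLp (Fin n)).lintegral_comp_emb
        (MeasurableEquiv.toLp 2 _).measurableEmbedding (fun y => F (√(a ^ 2 + ‖y‖ ^ 2), a))
    _ = _ := by
      have : ∀ a : ℝ, Measurable fun y : ℝ => F (√(a ^ 2 + y ^ 2), a) := fun a => by fun_prop
      simp_rw [fun a => lintegral_fun_norm_addHaar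
        (volume : Measure (EuclideanSpace ℝ (Fin n))) (this a)]
      rw [lintegral_const_mul]
      · simp
      · refine Measurable.lintegral_prod_right' (f := fun z : ℝ × ℝ =>
          ENNReal.ofReal (z.2 ^ (Module.finrank ℝ (EuclideanSpace ℝ (Fin n)) - 1)) *
            F (√(z.1 ^ 2 + z.2 ^ 2), z.1)) ?_
        fun_prop

/-- Integration over the open half plane in polar coordinates. -/
theorem lintegral_halfPlane_polar {G : ℝ × ℝ → ENNReal} (hG : Measurable G) :
    ∫⁻ a : ℝ, ∫⁻ y in Ioi (0 : ℝ), G (a, y) =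
      ∫⁻ s in Ioi (0 : ℝ), ∫⁻ θ in Ioo 0 Real.pi,
        ENNReal.ofReal s * G (s * Real.cos θ, s * Real.sin θ) := by
  have hH : Measurable fun z : ℝ × ℝ => (Ioi (0 : ℝ)).indicator (fun y => G (z.1, y)) z.2 := by
    have : (fun z : ℝ × ℝ => (Ioi (0 : ℝ)).indicator (fun y => G (z.1, y)) z.2) =
        (Prod.snd ⁻¹' Ioi (0 : ℝ)).indicator G := by
      ext z; simp [indicator]
    rw [this]
    exact hG.indicator (measurable_snd measurableSet_Ioi)
  calc
    _ = ∫⁻ a : ℝ, ∫⁻ y : ℝ, (Ioi (0 : ℝ)).indicator (fun y => G (a, y)) y := by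
      simp_rw [lintegral_indicator measurableSet_Ioi]
    _ = ∫⁻ z : ℝ × ℝ, (Ioi (0 : ℝ)).indicator (fun y => G (z.1, y)) z.2 := by
      rw [Measure.volume_eq_prod, lintegral_prod _ hH.aemeasurable]
    _ = ∫⁻ s in Ioi (0 : ℝ), ∫⁻ θ in Ioo (-Real.pi) Real.pi, ENNReal.ofReal s *
          (Ioi (0 : ℝ)).indicator (fun y => G (s * Real.cos θ, y)) (s * Real.sin θ) := by
      rw [← lintegral_comp_polarCoord_symm, polarCoord_target, Measure.volume_eq_prod,
        ← Measure.prod_restrict, lintegral_prod]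
      · rfl
      · refine Measurable.aemeasurable ?_
        exact (measurable_fst.ennreal_ofReal).mul
          (hH.comp continuous_polarCoord_symm.measurable)
    _ = _ := by
      refine setLIntegral_congr_fun measurableSet_Ioi fun s (hs : 0 < s) => ?_
      rw [← lintegral_indicator measurableSet_Ioo, ← lintegral_indicator measurableSet_Ioo]
      refine lintegral_congr fun θ => ?_
      by_cases h1 : θ ∈ Ioo 0 Real.pi
      · have h2 : θ ∈ Ioo (-Real.pi) Real.pi := ⟨by linarith [h1.1, Real.pi_pos], h1.2⟩
        have h3 : s * Real.sin θ ∈ Ioi (0 : ℝ) := mul_pos hs (Real.sin_pos_of_mem_Ioo h1)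
        simp only [indicator_of_mem h1, indicator_of_mem h2, indicator_of_mem h3]
      · rw [indicator_of_notMem h1]
        by_cases h2 : θ ∈ Ioo (-Real.pi) Real.pi
        · have h4 : θ ≤ 0 := by
            by_contra h; exact h1 ⟨not_le.1 h, h2.2⟩
          have h3 : s * Real.sin θ ∉ Ioi (0 : ℝ) := by
            simp only [mem_Ioi, not_lt]
            exact mul_nonpos_of_nonneg_of_nonpos hs.le
              (Real.sin_nonpos_of_nonpos_of_neg_pi_le h4 h2.1.le)
          rw [indicator_of_mem h2, indicator_of_notMem h3, mul_zero]
        · rw [indicator_of_notMem h2]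

/-- The substitution `b = (1 + cos θ) / 2`. -/
theorem lintegral_sin_pow_mul_comp_cos {n : ℕ} (hn : 1 ≤ n) (f : ℝ → ENNReal) :
    ∫⁻ θ in Ioo 0 Real.pi, ENNReal.ofReal (Real.sin θ ^ (n - 1)) * f (Real.cos θ) =
      ENNReal.ofReal (2 ^ (n - 1)) * ∫⁻ b in Ioo (0 : ℝ) 1,
        ENNReal.ofReal (b ^ ((n : ℝ) / 2 - 1) * (1 - b) ^ ((n : ℝ) / 2 - 1)) *
          f (2 * b - 1) := by
  have himg : (fun θ : ℝ => (1 + Real.cos θ) / 2) '' Ioo 0 Real.pi = Ioo 0 1 := by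
    ext b
    constructor
    · rintro ⟨θ, hθ, rfl⟩
      have h1 := Real.strictAntiOn_cos (left_mem_Icc.2 Real.pi_pos.le) ⟨hθ.1.le, hθ.2.le⟩ hθ.1
      have h2 := Real.strictAntiOn_cos ⟨hθ.1.le, hθ.2.le⟩ (right_mem_Icc.2 Real.pi_pos.le) hθ.2
      rw [Real.cos_zero] at h1
      rw [Real.cos_pi] at h2
      constructor <;> dsimp only <;> linarith
    · rintro ⟨h0, h1⟩
      refine ⟨Real.arccos (2 * b - 1), ⟨?_, ?_⟩, ?_⟩
      · rw [Real.arccos_pos]; linarith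
      · refine lt_of_le_of_ne (Real.arccos_le_pi _) fun h => ?_
        rw [Real.arccos_eq_pi] at h; linarith
      · dsimp only
        rw [Real.cos_arccos (by linarith) (by linarith)]; ring
  have hinj : InjOn (fun θ : ℝ => (1 + Real.cos θ) / 2) (Ioo 0 Real.pi) := by
    intro x hx y hy hxy
    refine Real.injOn_cos ⟨hx.1.le, hx.2.le⟩ ⟨hy.1.le, hy.2.le⟩ ?_
    dsimp only at hxy; linarith
  have hder : ∀ θ ∈ Ioo 0 Real.pi, HasDerivWithinAt (fun θ : ℝ => (1 + Real.cos θ) / 2)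
      (-Real.sin θ / 2) (Ioo 0 Real.pi) θ := fun θ _ =>
    (((Real.hasDerivAt_cos θ).const_add 1).div_const 2).hasDerivWithinAt
  rw [← himg, lintegral_image_eq_lintegral_abs_deriv_mul measurableSet_Ioo hder hinj,
    ← lintegral_const_mul' _ _ ENNReal.ofReal_ne_top]
  refine setLIntegral_congr_fun measurableSet_Ioo fun θ hθ => ?_
  have hs := Real.sin_pos_of_mem_Ioo hθ
  have hc : 2 * ((1 + Real.cos θ) / 2) - 1 = Real.cos θ := by ring
  have hb0 : 0 ≤ (1 + Real.cos θ) / 2 := by linarith [Real.neg_one_le_cos θ]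
  have hb1 : 0 ≤ 1 - (1 + Real.cos θ) / 2 := by linarith [Real.cos_le_one θ]
  rw [hc, ← mul_assoc, ← mul_assoc, ← ENNReal.ofReal_mul (by positivity),
    ← ENNReal.ofReal_mul (by positivity)]
  congr 2
  -- With `b (1 - b) = (sin θ / 2)²` and `|db/dθ| = sin θ / 2`, the total power of `sin θ / 2` is `2
  -- (n/2 - 1) + 1 = n - 1`, which explains the factor `2 ^ (n - 1)`.
  have hprod : (1 + Real.cos θ) / 2 * (1 - (1 + Real.cos θ) / 2) = (Real.sin θ / 2) ^ 2 := by
    have := Real.sin_sq_add_cos_sq θ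
    linear_combination (-1 / 4) * this
  have habs : |-Real.sin θ / 2| = Real.sin θ / 2 := by
    rw [neg_div, abs_neg, abs_of_pos (by positivity)]
  have hexp : (2 : ℝ) * ((n : ℝ) / 2 - 1) + 1 = ((n - 1 : ℕ) : ℝ) := by
    rw [Nat.cast_sub hn]; push_cast; ring
  rw [← Real.mul_rpow hb0 hb1, hprod, habs, ← Real.rpow_natCast (Real.sin θ / 2) 2,
    ← Real.rpow_mul (by positivity), mul_assoc,
    mul_comm (Real.sin θ / 2), ← Real.rpow_add_one (by positivity)]
  push_cast
  rw [hexp, Real.rpow_natCast, ← mul_pow]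
  congr 1; ring

/-- Integrals of functions of `‖x‖` and of one coordinate, in terms of the norm and of the
variable `b = (1 + cos θ) / 2`. -/
theorem lintegral_norm_inner_eq_polar {n : ℕ} (hn : 1 ≤ n)
    (e : EuclideanSpace ℝ (Fin (n + 1))) (he : ‖e‖ = 1) {F : ℝ × ℝ → ENNReal}
    (hF : Measurable F) :
    ∫⁻ x : EuclideanSpace ℝ (Fin (n + 1)), F (‖x‖, inner ℝ e x) =
      (volume : Measure (EuclideanSpace ℝ (Fin n))).toSphere univ *
        (ENNReal.ofReal (2 ^ (n - 1)) * ∫⁻ s in Ioi (0 : ℝ), ENNReal.ofReal (s ^ n) *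
          ∫⁻ b in Ioo (0 : ℝ) 1,
            ENNReal.ofReal (b ^ ((n : ℝ) / 2 - 1) * (1 - b) ^ ((n : ℝ) / 2 - 1)) *
              F (s, s * (2 * b - 1))) := by
  rw [lintegral_norm_inner_eq_cylindrical hn e he hF]
  congr 1
  rw [lintegral_halfPlane_polar (G := fun z => ENNReal.ofReal (z.2 ^ (n - 1)) *
    F (√(z.1 ^ 2 + z.2 ^ 2), z.1)) (by fun_prop), ← lintegral_const_mul' _ _ ENNReal.ofReal_ne_top]
  refine setLIntegral_congr_fun measurableSet_Ioi fun s (hs : 0 < s) => ?_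
  dsimp only
  rw [mul_left_comm, ← lintegral_sin_pow_mul_comp_cos hn fun c => F (s, s * c),
    ← lintegral_const_mul' _ _ ENNReal.ofReal_ne_top]
  refine setLIntegral_congr_fun measurableSet_Ioo fun θ hθ => ?_
  have hsin := Real.sin_pos_of_mem_Ioo hθ
  have hsq : (s * Real.cos θ) ^ 2 + (s * Real.sin θ) ^ 2 = s ^ 2 := by
    have := Real.sin_sq_add_cos_sq θ
    linear_combination s ^ 2 * this
  rw [hsq, Real.sqrt_sq hs.le, ← mul_assoc, ← mul_assoc, ← ENNReal.ofReal_mul hs.le,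
    ← ENNReal.ofReal_mul (by positivity)]
  congr 2
  rw [mul_pow, ← mul_assoc, mul_comm s, ← pow_succ, Nat.sub_add_cancel hn]

/-! ### The beta and gamma distributions -/

theorem lintegral_betaMeasure {a : ℝ} (ha : 0 < a) {f : ℝ → ENNReal} (hf : Measurable f) :
    ∫⁻ b, f b ∂betaMeasure a a = ENNReal.ofReal (1 / beta a a) *
      ∫⁻ b in Ioo (0 : ℝ) 1, ENNReal.ofReal (b ^ (a - 1) * (1 - b) ^ (a - 1)) * f b := by
  have hm : Measurable (betaPDF a a) := (measurable_betaPDFReal a a).ennreal_ofReal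
  have hpos := beta_pos ha ha
  rw [betaMeasure, lintegral_withDensity_eq_lintegral_mul _ hm hf,
    ← lintegral_const_mul' _ _ ENNReal.ofReal_ne_top, ← lintegral_indicator measurableSet_Ioo]
  refine lintegral_congr fun b => ?_
  by_cases hb : b ∈ Ioo (0 : ℝ) 1
  · rw [indicator_of_mem hb, Pi.mul_apply, betaPDF_of_pos_lt_one hb.1 hb.2, ← mul_assoc,
      ← ENNReal.ofReal_mul (by positivity), mul_assoc (1 / beta a a)]
  · rw [indicator_of_notMem hb, Pi.mul_apply, betaPDF_eq, if_neg (show ¬(0 < b ∧ b < 1) from hb)]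
    simp

theorem lintegral_gammaMeasure_one {a : ℝ} {f : ℝ → ENNReal} (hf : Measurable f) :
    ∫⁻ t, f t ∂gammaMeasure a 1 =
      ∫⁻ t in Ioi (0 : ℝ),
        ENNReal.ofReal (1 / Real.Gamma a * t ^ (a - 1) * Real.exp (-t)) * f t := by
  have hm : Measurable (gammaPDF a 1) := (measurable_gammaPDFReal a 1).ennreal_ofReal
  rw [gammaMeasure, lintegral_withDensity_eq_lintegral_mul _ hm hf, ← lintegral_indicator
    measurableSet_Ioi]
  refine lintegral_congr_ae ?_
  -- `gammaPDF` uses the formula for `t ≥ 0` at the endpoint as well, while the right side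
  -- integrates over `t > 0`.
  filter_upwards [Measure.ae_ne volume (0 : ℝ)] with t ht
  rcases lt_or_gt_of_ne ht with h | h
  · rw [Pi.mul_apply, gammaPDF_of_neg h, indicator_of_notMem (by simpa using h.le), zero_mul]
  · rw [Pi.mul_apply, gammaPDF_of_nonneg h.le, indicator_of_mem (mem_Ioi.2 h)]
    simp

theorem ae_gammaMeasure_pos {a : ℝ} : ∀ᵐ t ∂gammaMeasure a 1, 0 < t := by
  have h := lintegral_gammaMeasure_one (a := a)
    (f := (Iic (0 : ℝ)).indicator 1) (measurable_one.indicator measurableSet_Iic)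
  rw [lintegral_indicator_one measurableSet_Iic] at h
  rw [ae_iff]
  simp only [not_lt]
  refine h.trans ?_
  rw [setLIntegral_congr_fun measurableSet_Ioi (g := 0)]
  · simp
  · intro t ht
    simp [not_le.2 (mem_Ioi.1 ht)]

/-- Absence of atoms allows strict and weak inequalities to be exchanged at the thresholds. -/
instance nullSingletonClass_gammaMeasure {a r : ℝ} : NullSingletonClass (gammaMeasure a r) := by
  unfold gammaMeasure; infer_instance

instance nullSingletonClass_betaMeasure {a b : ℝ} : NullSingletonClass (betaMeasure a b) := by
  unfold betaMeasure; infer_instance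

theorem ae_betaMeasure_mem_Ioo {a : ℝ} (ha : 0 < a) : ∀ᵐ b ∂betaMeasure a a, b ∈ Ioo (0 : ℝ) 1 := by
  have h := lintegral_betaMeasure ha
    (f := (Ioo (0 : ℝ) 1)ᶜ.indicator 1) (measurable_one.indicator measurableSet_Ioo.compl)
  rw [lintegral_indicator_one measurableSet_Ioo.compl] at h
  rw [ae_iff]
  refine h.trans ?_
  rw [setLIntegral_congr_fun measurableSet_Ioo (g := 0)]
  · simp
  · intro t ht
    simp only [indicator_of_notMem (notMem_compl_iff.2 ht), mul_zero, Pi.zero_apply]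

/-- The density is positive on `(0, c)`. This ensures that `nu` is a genuine inverse and not the
default value `0⁻¹ = 0`. -/
theorem measure_gammaMeasure_Iic_pos {a : ℝ} (ha : 0 < a) {c : ℝ} (hc : 0 < c) :
    gammaMeasure a 1 (Iic c) ≠ 0 := by
  have h := lintegral_gammaMeasure_one (a := a)
    (f := (Iic c).indicator 1) (measurable_one.indicator measurableSet_Iic)
  rw [lintegral_indicator_one measurableSet_Iic] at h
  rw [h, ← lintegral_indicator measurableSet_Ioi]
  refine (lintegral_pos_iff_support ?_).2 ?_ |>.ne'
  · refine Measurable.indicator ?_ measurableSet_Ioi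
    refine Measurable.mul ?_ (measurable_one.indicator measurableSet_Iic)
    fun_prop
  · refine lt_of_lt_of_le ?_ (measure_mono (s := Ioo 0 c) ?_)
    · simpa using hc
    · intro t ht
      have h1 : 0 < Real.Gamma a := Real.Gamma_pos_of_pos ha
      have h2 : 0 < t := ht.1
      have h3 : 0 < 1 / Real.Gamma a * t ^ (a - 1) * Real.exp (-t) := by positivity
      rw [Function.mem_support, indicator_of_mem (mem_Ioi.2 h2), indicator_of_mem (mem_Iic.2 ht.2.le)]
      simpa using h3

/-! ### The law of the norm and of one coordinate -/

theorem sigma'_pos {d k : ℕ} (hkd : 2 * k < d) {σ : ℝ} (hσ : 0 < σ) : 0 < sigma' d k σ := by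
  have h : (2 * k : ℝ) < d := by exact_mod_cast hkd
  have h1 : (0 : ℝ) ≤ k := by positivity
  have : 0 < (d : ℝ) / ((d : ℝ) - 2 * k) := div_pos (by linarith) (by linarith)
  unfold sigma'
  positivity

theorem measurable_rad (d k : ℕ) (σ : ℝ) : Measurable (rad d k σ) := by
  unfold rad; fun_prop

theorem shape_pos {d k : ℕ} (hkd : 2 * k < d) : 0 < (d : ℝ) / 2 - k := by
  have h : (2 * k : ℝ) < d := by exact_mod_cast hkd
  linarith

/-- The substitution `s = c √(2t)`. -/
theorem lintegral_Ioi_comp_mul_sqrt {c : ℝ} (hc : 0 < c) (f : ℝ → ENNReal) :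
    ∫⁻ s in Ioi (0 : ℝ), f s =
      ∫⁻ t in Ioi (0 : ℝ), ENNReal.ofReal (c / √(2 * t)) * f (c * √(2 * t)) := by
  have himg : (fun t : ℝ => c * √(2 * t)) '' Ioi 0 = Ioi 0 := by
    ext s
    constructor
    · rintro ⟨t, ht, rfl⟩
      have : 0 < t := ht
      exact mem_Ioi.2 (by positivity)
    · intro hs
      have hs' : 0 < s := hs
      refine ⟨(s / c) ^ 2 / 2, mem_Ioi.2 (by positivity), ?_⟩
      dsimp only
      rw [mul_div_cancel₀ _ two_ne_zero, Real.sqrt_sq (by positivity), mul_div_cancel₀ _ hc.ne']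
  have hinj : InjOn (fun t : ℝ => c * √(2 * t)) (Ioi 0) := by
    intro x hx y hy hxy
    have hx' : 0 < x := hx
    have hy' : 0 < y := hy
    have h := mul_left_cancel₀ hc.ne' hxy
    rw [Real.sqrt_inj (by positivity) (by positivity)] at h
    linarith
  have hder : ∀ t ∈ Ioi (0 : ℝ), HasDerivWithinAt (fun t : ℝ => c * √(2 * t))
      (c / √(2 * t)) (Ioi 0) t := by
    intro t ht
    have ht' : 0 < t := ht
    have h := (((hasDerivAt_id t).const_mul 2).sqrt (by simpa using ht'.ne')).const_mul c
    refine HasDerivAt.hasDerivWithinAt ?_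
    have hv : c / √(2 * t) = c * (2 * 1 / (2 * √(2 * id t))) := by
      simp only [id]; field_simp
    rw [hv]
    exact h
  nth_rewrite 1 [← himg]
  rw [lintegral_image_eq_lintegral_abs_deriv_mul measurableSet_Ioi hder hinj]
  refine setLIntegral_congr_fun measurableSet_Ioi fun t ht => ?_
  rw [abs_of_nonneg (by positivity)]

/-- With `s = c√(2t)` the exponent of `e` is `-t`, and the powers of `√(2t)` add up to `n - 2k - 1`,
twice the exponent `(n + 1)/2 - k - 1` of the gamma density. -/
theorem radial_jacobian_eq {n k : ℕ} {c t : ℝ} (hc : 0 < c) (ht : 0 < t) :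
    c / √(2 * t) * ((c * √(2 * t)) ^ n *
        (((c * √(2 * t)) ^ (2 * k))⁻¹ * Real.exp (-(c * √(2 * t)) ^ 2 / (2 * c ^ 2)))) =
      c * c ^ n * (c ^ (2 * k))⁻¹ * 2 ^ (((n + 1 : ℕ) : ℝ) / 2 - k - 1) *
        (t ^ (((n + 1 : ℕ) : ℝ) / 2 - k - 1) * Real.exp (-t)) := by
  have h2t : 0 < 2 * t := by positivity
  have hexp : -(c * √(2 * t)) ^ 2 / (2 * c ^ 2) = -t := by
    rw [mul_pow, Real.sq_sqrt h2t.le]; field_simp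
  have hpow : (2 : ℝ) ^ (((n + 1 : ℕ) : ℝ) / 2 - k - 1) * t ^ (((n + 1 : ℕ) : ℝ) / 2 - k - 1) =
      √(2 * t) ^ n * (√(2 * t) ^ (2 * k))⁻¹ * (√(2 * t))⁻¹ := by
    rw [← Real.mul_rpow (by norm_num) ht.le, Real.sqrt_eq_rpow, ← Real.rpow_mul_natCast h2t.le,
      ← Real.rpow_mul_natCast h2t.le, ← Real.rpow_neg h2t.le, ← Real.rpow_neg h2t.le,
      ← Real.rpow_add h2t, ← Real.rpow_add h2t]
    congr 1
    push_cast; ring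
  rw [hexp]
  calc _ = c * c ^ n * (c ^ (2 * k))⁻¹ *
        (√(2 * t) ^ n * (√(2 * t) ^ (2 * k))⁻¹ * (√(2 * t))⁻¹) * Real.exp (-t) := by
        rw [mul_pow, mul_pow, mul_inv]; ring
    _ = _ := by rw [← hpow]; ring

/-- Under the weight of the generalized Gaussian, the pair (norm, coordinate along `e`) is
distributed, up to a constant factor, as `(s, s (2b - 1))` with `s = σ'√(2t)` for independent
`t ∼ Γ(d/2 - k, 1)` and `b ∼ Beta((d-1)/2, (d-1)/2)`. -/
theorem exists_lintegral_genGaussianWeight_mul {d k : ℕ} (hk : 1 ≤ k) (hkd : 2 * k < d) {σ : ℝ}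
    (hσ : 0 < σ) : ∃ C : ENNReal, C ≠ 0 ∧ C ≠ ⊤ ∧
      ∀ e : EuclideanSpace ℝ (Fin d), ‖e‖ = 1 → ∀ F : ℝ × ℝ → ENNReal, Measurable F →
        ∫⁻ x, ENNReal.ofReal (genGaussianWeight d k σ x) * F (‖x‖, inner ℝ e x) =
          C * ∫⁻ t, ∫⁻ b, F (rad d k σ t, rad d k σ t * (2 * b - 1))
            ∂betaMeasure (((d : ℝ) - 1) / 2) (((d : ℝ) - 1) / 2) ∂gammaLaw d k := by
  obtain ⟨n, rfl⟩ : ∃ n, d = n + 1 := ⟨d - 1, by omega⟩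
  have hn : 1 ≤ n := by omega
  have hshape := shape_pos hkd
  have hn' : (0 : ℝ) < n := by exact_mod_cast hn
  have hhalf : (0 : ℝ) < ((((n + 1 : ℕ) : ℝ) - 1) / 2) := by push_cast; linarith
  have hab : ((((n + 1 : ℕ) : ℝ) - 1) / 2) - 1 = (n : ℝ) / 2 - 1 := by push_cast; ring
  set a : ℝ := (((n + 1 : ℕ) : ℝ) - 1) / 2 with ha
  set g : ℝ := ((n + 1 : ℕ) : ℝ) / 2 - k with hg
  set c := sigma' (n + 1) k σ with hcdef
  have hc : 0 < c := sigma'_pos hkd hσ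
  have hG : 0 < Real.Gamma g := Real.Gamma_pos_of_pos hshape
  have hB : 0 < beta a a := beta_pos hhalf hhalf
  set S := (volume : Measure (EuclideanSpace ℝ (Fin n))).toSphere univ with hS
  set K : ℝ := c * c ^ n * (c ^ (2 * k))⁻¹ * 2 ^ (g - 1) with hK
  have hKpos : 0 < K := by positivity
  have : Nontrivial (EuclideanSpace ℝ (Fin n)) := by
    have : Nonempty (Fin n) := ⟨⟨0, hn⟩⟩
    infer_instance
  have hS0 : S ≠ 0 := by
    rw [hS, Ne, Measure.measure_univ_eq_zero]
    exact Measure.toSphere_ne_zero _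
  -- `S` and `2 ^ (n - 1)` come from the change of coordinates, `K` from `radial_jacobian_eq`; the
  -- values of Gamma and beta undo the normalization of the two laws.
  refine ⟨S * (ENNReal.ofReal (2 ^ (n - 1)) * ENNReal.ofReal (K * Real.Gamma g * beta a a)),
    ?_, ?_, fun e he F hF => ?_⟩
  · refine mul_ne_zero hS0 (mul_ne_zero ?_ ?_)
    · rw [Ne, ENNReal.ofReal_eq_zero, not_le]; positivity
    · rw [Ne, ENNReal.ofReal_eq_zero, not_le]; positivity
  · exact ENNReal.mul_ne_top (measure_ne_top _ _)
      (ENNReal.mul_ne_top ENNReal.ofReal_ne_top ENNReal.ofReal_ne_top)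
  · set w : ℝ → ℝ := fun s => (s ^ (2 * k))⁻¹ * Real.exp (-s ^ 2 / (2 * c ^ 2)) with hw
    have hw0 : ∀ s, 0 ≤ w s := fun s => by
      have : 0 ≤ s ^ (2 * k) := by rw [pow_mul]; positivity
      simp only [hw]; positivity
    have hwm : Measurable w := by fun_prop
    have h1 := lintegral_norm_inner_eq_polar hn e he
      (F := fun z => ENNReal.ofReal (w z.1) * F z) (by fun_prop)
    have h2 : ∀ s, ∫⁻ b in Ioo (0 : ℝ) 1,
        ENNReal.ofReal (b ^ ((n : ℝ) / 2 - 1) * (1 - b) ^ ((n : ℝ) / 2 - 1)) *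
          (ENNReal.ofReal (w s) * F (s, s * (2 * b - 1))) =
        ENNReal.ofReal (w s) * (ENNReal.ofReal (beta a a) *
          ∫⁻ b, F (s, s * (2 * b - 1)) ∂betaMeasure a a) := by
      intro s
      rw [lintegral_betaMeasure hhalf (f := fun b => F (s, s * (2 * b - 1))) (by fun_prop),
        ← mul_assoc (ENNReal.ofReal (beta a a)), ← ENNReal.ofReal_mul hB.le,
        mul_one_div_cancel hB.ne', ENNReal.ofReal_one, one_mul, hab,
        ← lintegral_const_mul' _ _ ENNReal.ofReal_ne_top]
      exact lintegral_congr fun b => mul_left_comm _ _ _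
    have hFm : Measurable fun t : ℝ => ∫⁻ b, F (rad (n + 1) k σ t, rad (n + 1) k σ t * (2 * b - 1))
        ∂betaMeasure a a := by
      have : IsProbabilityMeasure (betaMeasure a a) := isProbabilityMeasureBeta hhalf hhalf
      have hr := measurable_rad (n + 1) k σ
      refine Measurable.lintegral_prod_right' (f := fun z : ℝ × ℝ =>
        F (rad (n + 1) k σ z.1, rad (n + 1) k σ z.1 * (2 * z.2 - 1))) ?_
      fun_prop
    simp_rw [h2] at h1
    refine h1.trans ?_
    rw [lintegral_Ioi_comp_mul_sqrt hc, gammaLaw, lintegral_gammaMeasure_one hFm, mul_assoc,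
      mul_assoc]
    congr 2
    rw [← lintegral_const_mul' _ _ ENNReal.ofReal_ne_top]
    refine setLIntegral_congr_fun measurableSet_Ioi fun t (ht : 0 < t) => ?_
    have hr : c * √(2 * t) = rad (n + 1) k σ t := rfl
    have hpos : 0 ≤ (c * √(2 * t)) ^ n := by positivity
    rw [← mul_assoc, ← mul_assoc, ← mul_assoc, ← mul_assoc, ← ENNReal.ofReal_mul (by positivity),
      ← ENNReal.ofReal_mul (by positivity), ← ENNReal.ofReal_mul (mul_nonneg (by positivity) (hw0 _)),
      ← ENNReal.ofReal_mul (by positivity)]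
    rw [hr]
    congr 2
    have := radial_jacobian_eq (n := n) (k := k) hc ht
    rw [← hr]
    simp only [hw]
    rw [mul_assoc (c / √(2 * t)), this, ← hg, ← hK]
    field_simp

/-! ### Normalization of the densities -/

/-- The law `Beta((d-1)/2, (d-1)/2)`. -/
noncomputable def angleLaw (d : ℕ) : Measure ℝ :=
  betaMeasure (((d : ℝ) - 1) / 2) (((d : ℝ) - 1) / 2)

theorem half_pred_pos {d k : ℕ} (hk : 1 ≤ k) (hkd : 2 * k < d) : 0 < ((d : ℝ) - 1) / 2 := by
  have : ((1 : ℕ) : ℝ) < d := by exact_mod_cast (by omega : 1 < d)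
  push_cast at this
  linarith

theorem isProbabilityMeasure_angleLaw {d k : ℕ} (hk : 1 ≤ k) (hkd : 2 * k < d) :
    IsProbabilityMeasure (angleLaw d) :=
  isProbabilityMeasureBeta (half_pred_pos hk hkd) (half_pred_pos hk hkd)

theorem isProbabilityMeasure_gammaLaw {d k : ℕ} (hkd : 2 * k < d) :
    IsProbabilityMeasure (gammaLaw d k) :=
  isProbabilityMeasure_gammaMeasure (shape_pos hkd) one_pos

/-- The weight of the generalized Gaussian as a function of the norm. -/
noncomputable def radialWeight (d k : ℕ) (σ s : ℝ) : ℝ :=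
  (s ^ (2 * k))⁻¹ * Real.exp (-s ^ 2 / (2 * sigma' d k σ ^ 2))

theorem genGaussianWeight_eq_radialWeight (d k : ℕ) (σ : ℝ) (x : EuclideanSpace ℝ (Fin d)) :
    genGaussianWeight d k σ x = radialWeight d k σ ‖x‖ := rfl

theorem measurable_radialWeight (d k : ℕ) (σ : ℝ) : Measurable (radialWeight d k σ) := by
  unfold radialWeight; fun_prop

theorem measurable_genGaussianWeight (d k : ℕ) (σ : ℝ) :
    Measurable (genGaussianWeight d k σ) :=
  (measurable_radialWeight d k σ).comp measurable_norm

theorem genGaussianWeight_nonneg (d k : ℕ) (σ : ℝ) (x : EuclideanSpace ℝ (Fin d)) :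
    0 ≤ genGaussianWeight d k σ x := by
  unfold genGaussianWeight; positivity

theorem rad_nonneg {d k : ℕ} (hkd : 2 * k < d) {σ : ℝ} (hσ : 0 < σ) (t : ℝ) :
    0 ≤ rad d k σ t := by
  have := sigma'_pos hkd hσ
  unfold rad; positivity

theorem rad_pos {d k : ℕ} (hkd : 2 * k < d) {σ t : ℝ} (hσ : 0 < σ) (ht : 0 < t) :
    0 < rad d k σ t := by
  have := sigma'_pos hkd hσ
  unfold rad; positivity

theorem rad_sq {d k : ℕ} {σ t : ℝ} (ht : 0 ≤ t) :
    rad d k σ t ^ 2 = 2 * sigma' d k σ ^ 2 * t := by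
  rw [rad, mul_pow, Real.sq_sqrt (by positivity)]; ring

theorem rad_le_iff {d k : ℕ} (hkd : 2 * k < d) {σ T : ℝ} (hσ : 0 < σ) (hT : 0 < T) (t : ℝ) :
    rad d k σ t ≤ T ↔ t ≤ T ^ 2 / (2 * sigma' d k σ ^ 2) := by
  have hs := sigma'_pos hkd hσ
  -- For negative `t` the square root takes the default value `0`, and both sides hold.
  rcases lt_or_ge t 0 with ht | ht
  · have h1 : rad d k σ t = 0 := by
      rw [rad, Real.sqrt_eq_zero_of_nonpos (by linarith), mul_zero]
    rw [h1]
    exact iff_of_true hT.le (ht.le.trans (by positivity))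
  · rw [← sq_le_sq₀ (rad_nonneg hkd hσ t) hT.le, rad_sq ht, le_div_iff₀ (by positivity), mul_comm]

theorem exists_unit_vector {d k : ℕ} (hkd : 2 * k < d) :
    ∃ e : EuclideanSpace ℝ (Fin d), ‖e‖ = 1 :=
  ⟨EuclideanSpace.single ⟨0, by omega⟩ 1, by simp⟩

/-- Taking `F = 1` identifies the constant, since both laws on the right have mass one. -/
theorem lintegral_genGaussianWeight {d k : ℕ} (hk : 1 ≤ k) (hkd : 2 * k < d) {C : ENNReal}
    {σ : ℝ} (hC : ∀ e : EuclideanSpace ℝ (Fin d), ‖e‖ = 1 → ∀ F : ℝ × ℝ → ENNReal, Measurable F →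
        ∫⁻ x, ENNReal.ofReal (genGaussianWeight d k σ x) * F (‖x‖, inner ℝ e x) =
          C * ∫⁻ t, ∫⁻ b, F (rad d k σ t, rad d k σ t * (2 * b - 1))
            ∂betaMeasure (((d : ℝ) - 1) / 2) (((d : ℝ) - 1) / 2) ∂gammaLaw d k) :
    ∫⁻ x, ENNReal.ofReal (genGaussianWeight d k σ x) = C := by
  have := isProbabilityMeasure_gammaLaw hkd
  have := isProbabilityMeasureBeta (half_pred_pos hk hkd) (half_pred_pos hk hkd)
  obtain ⟨e, he⟩ := exists_unit_vector hkd
  simpa using hC e he (fun _ => 1) measurable_const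

theorem lintegral_genGaussianWeight_ne_zero_ne_top {d k : ℕ} (hk : 1 ≤ k) (hkd : 2 * k < d) {σ : ℝ}
    (hσ : 0 < σ) :
    ∫⁻ x, ENNReal.ofReal (genGaussianWeight d k σ x) ≠ 0 ∧
      ∫⁻ x, ENNReal.ofReal (genGaussianWeight d k σ x) ≠ ⊤ := by
  obtain ⟨C, h0, h1, hC⟩ := exists_lintegral_genGaussianWeight_mul hk hkd hσ
  rw [lintegral_genGaussianWeight hk hkd hC]
  exact ⟨h0, h1⟩

theorem lintegral_genGaussianWeight_mul {d k : ℕ} (hk : 1 ≤ k) (hkd : 2 * k < d) {σ : ℝ}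
    (hσ : 0 < σ) {e : EuclideanSpace ℝ (Fin d)} (he : ‖e‖ = 1) {F : ℝ × ℝ → ENNReal}
    (hF : Measurable F) :
    ∫⁻ x, ENNReal.ofReal (genGaussianWeight d k σ x) * F (‖x‖, inner ℝ e x) =
      (∫⁻ x, ENNReal.ofReal (genGaussianWeight d k σ x)) *
        ∫⁻ t, ∫⁻ b, F (rad d k σ t, rad d k σ t * (2 * b - 1)) ∂angleLaw d ∂gammaLaw d k := by
  obtain ⟨C, h0, h1, hC⟩ := exists_lintegral_genGaussianWeight_mul hk hkd hσ
  rw [lintegral_genGaussianWeight hk hkd hC]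
  exact hC e he F hF

theorem integral_genGaussianWeight (d k : ℕ) (σ : ℝ) :
    ∫ x, genGaussianWeight d k σ x =
      (∫⁻ x, ENNReal.ofReal (genGaussianWeight d k σ x)).toReal :=
  integral_eq_lintegral_of_nonneg_ae (ae_of_all _ (genGaussianWeight_nonneg d k σ))
    (measurable_genGaussianWeight d k σ).aestronglyMeasurable

theorem integral_genGaussianWeight_pos {d k : ℕ} (hk : 1 ≤ k) (hkd : 2 * k < d) {σ : ℝ}
    (hσ : 0 < σ) : 0 < ∫ x, genGaussianWeight d k σ x := by
  rw [integral_genGaussianWeight]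
  obtain ⟨h0, h1⟩ := lintegral_genGaussianWeight_ne_zero_ne_top hk hkd hσ
  exact ENNReal.toReal_pos h0 h1

/-- The probability of an event that depends on the norm and on the coordinate along `e` only. -/
theorem lawOfDensity_genGaussianDensity_apply {d k : ℕ} (hk : 1 ≤ k) (hkd : 2 * k < d) {σ : ℝ}
    (hσ : 0 < σ) {e : EuclideanSpace ℝ (Fin d)} (he : ‖e‖ = 1) {A : Set (ℝ × ℝ)}
    (hA : MeasurableSet A) :
    lawOfDensity (genGaussianDensity d k σ) {x | (‖x‖, inner ℝ e x) ∈ A} =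
      ∫⁻ t, angleLaw d {b | (rad d k σ t, rad d k σ t * (2 * b - 1)) ∈ A} ∂gammaLaw d k := by
  obtain ⟨h0, h1⟩ := lintegral_genGaussianWeight_ne_zero_ne_top hk hkd hσ
  have hZ := integral_genGaussianWeight_pos hk hkd hσ
  have hmap : Measurable fun x : EuclideanSpace ℝ (Fin d) => (‖x‖, inner ℝ e x) := by fun_prop
  have hS : MeasurableSet {x : EuclideanSpace ℝ (Fin d) | (‖x‖, inner ℝ e x) ∈ A} := hmap hA
  have key := lintegral_genGaussianWeight_mul hk hkd hσ he
    (F := A.indicator 1) (measurable_one.indicator hA)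
  have hofZ : ENNReal.ofReal (∫ x, genGaussianWeight d k σ x) =
      ∫⁻ x, ENNReal.ofReal (genGaussianWeight d k σ x) := by
    rw [integral_genGaussianWeight, ENNReal.ofReal_toReal h1]
  have hsec : ∀ t, ∫⁻ b, A.indicator 1 (rad d k σ t, rad d k σ t * (2 * b - 1)) ∂angleLaw d =
      angleLaw d {b | (rad d k σ t, rad d k σ t * (2 * b - 1)) ∈ A} := by
    intro t
    have hm : MeasurableSet {b | (rad d k σ t, rad d k σ t * (2 * b - 1)) ∈ A} := by
      have : Measurable fun b : ℝ => (rad d k σ t, rad d k σ t * (2 * b - 1)) := by fun_prop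
      exact this hA
    rw [← lintegral_indicator_one hm]
    rfl
  simp_rw [hsec] at key
  have hdens : ∀ x, ENNReal.ofReal (genGaussianDensity d k σ x) =
      (∫⁻ x, ENNReal.ofReal (genGaussianWeight d k σ x))⁻¹ *
        ENNReal.ofReal (genGaussianWeight d k σ x) := by
    intro x
    rw [genGaussianDensity, ENNReal.ofReal_div_of_pos hZ, hofZ, div_eq_mul_inv, mul_comm]
  rw [lawOfDensity, withDensity_apply _ hS]
  simp_rw [hdens]
  rw [lintegral_const_mul _ (measurable_genGaussianWeight d k σ).ennreal_ofReal,
    ← lintegral_indicator hS]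
  have hind : ∀ x : EuclideanSpace ℝ (Fin d),
      {x | (‖x‖, inner ℝ e x) ∈ A}.indicator
        (fun x => ENNReal.ofReal (genGaussianWeight d k σ x)) x =
      ENNReal.ofReal (genGaussianWeight d k σ x) * A.indicator 1 (‖x‖, inner ℝ e x) := by
    intro x
    by_cases hx : (‖x‖, inner ℝ e x) ∈ A
    · rw [indicator_of_mem hx, indicator_of_mem (show x ∈ {x | (‖x‖, inner ℝ e x) ∈ A} from hx)]
      simp
    · rw [indicator_of_notMem hx,
        indicator_of_notMem (show x ∉ {x | (‖x‖, inner ℝ e x) ∈ A} from hx)]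
      simp
  simp_rw [hind]
  rw [key, ← mul_assoc, ENNReal.inv_mul_cancel h0 h1, one_mul]

theorem measurable_angleLaw_section {d k : ℕ} (hk : 1 ≤ k) (hkd : 2 * k < d) (σ : ℝ)
    {A : Set (ℝ × ℝ)} (hA : MeasurableSet A) :
    Measurable fun t => angleLaw d {b | (rad d k σ t, rad d k σ t * (2 * b - 1)) ∈ A} := by
  have := isProbabilityMeasure_angleLaw hk hkd
  have hr := measurable_rad d k σ
  have hm : Measurable fun z : ℝ × ℝ => (rad d k σ z.1, rad d k σ z.1 * (2 * z.2 - 1)) := by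
    fun_prop
  exact measurable_measure_prodMk_left (hm hA)

/-- The probability of an event that depends on the norm and on the coordinate along `e` only, as
the expectation of any version of its conditional probability given the norm. -/
theorem integrable_and_lawOfDensity_real_eq_integral {d k : ℕ} (hk : 1 ≤ k) (hkd : 2 * k < d)
    {σ : ℝ} (hσ : 0 < σ) {e : EuclideanSpace ℝ (Fin d)} (he : ‖e‖ = 1) {A : Set (ℝ × ℝ)}
    (hA : MeasurableSet A) {u : ℝ → ℝ}
    (hu : ∀ᵐ t ∂gammaLaw d k,
      (angleLaw d).real {b | (rad d k σ t, rad d k σ t * (2 * b - 1)) ∈ A} = u t) :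
    Integrable u (gammaLaw d k) ∧
      (lawOfDensity (genGaussianDensity d k σ)).real {x | (‖x‖, inner ℝ e x) ∈ A} =
        ∫ t, u t ∂gammaLaw d k := by
  have := isProbabilityMeasure_angleLaw hk hkd
  have := isProbabilityMeasure_gammaLaw hkd
  have hm := measurable_angleLaw_section hk hkd σ hA
  constructor
  -- The conditional probability is measurable and bounded by `1`; integrability passes to `u` by
  -- almost everywhere equality, with no separate measurability proof for `u`.
  · refine Integrable.congr ?_ hu
    refine Integrable.of_bound hm.ennreal_toReal.aestronglyMeasurable 1 (ae_of_all _ fun t => ?_)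
    rw [Real.norm_of_nonneg measureReal_nonneg]
    exact measureReal_le_one
  · rw [← integral_congr_ae hu, measureReal_def,
      lawOfDensity_genGaussianDensity_apply hk hkd hσ he hA]
    exact (integral_toReal hm.aemeasurable (ae_of_all _ fun t => measure_lt_top _ _)).symm

theorem cdf_gammaLaw_pos {d k : ℕ} (hkd : 2 * k < d) {c : ℝ} (hc : 0 < c) :
    0 < cdf (gammaLaw d k) c := by
  have := isProbabilityMeasure_gammaLaw hkd
  rw [cdf_eq_real]
  exact ENNReal.toReal_pos (measure_gammaMeasure_Iic_pos (shape_pos hkd) hc) (measure_ne_top _ _)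

theorem nu_pos {d k : ℕ} (hkd : 2 * k < d) {T σ : ℝ} (hσ : 0 < σ) (hT : 0 < T) :
    0 < nu d k T σ := by
  have := sigma'_pos hkd hσ
  exact inv_pos.2 (cdf_gammaLaw_pos hkd (by positivity))

/-- By `rad_le_iff` the ball is the event `t ≤ T² / (2σ'²)`, so the ratio of the masses is a value
of the gamma CDF. -/
theorem integral_truncGenGaussianWeight {d k : ℕ} (hk : 1 ≤ k) (hkd : 2 * k < d) {T σ : ℝ}
    (hσ : 0 < σ) (hT : 0 < T) :
    ∫ x, truncGenGaussianWeight d k T σ x =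
      (∫ x, genGaussianWeight d k σ x) * (nu d k T σ)⁻¹ := by
  have := isProbabilityMeasure_angleLaw hk hkd
  have := isProbabilityMeasure_gammaLaw hkd
  obtain ⟨e, he⟩ := exists_unit_vector hkd
  have hS : MeasurableSet {z : ℝ × ℝ | z.1 ≤ T} := measurableSet_le measurable_fst measurable_const
  have key := lintegral_genGaussianWeight_mul hk hkd hσ he
    (F := {z : ℝ × ℝ | z.1 ≤ T}.indicator 1) (measurable_one.indicator hS)
  have hl : ∀ x : EuclideanSpace ℝ (Fin d), ENNReal.ofReal (truncGenGaussianWeight d k T σ x) =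
      ENNReal.ofReal (genGaussianWeight d k σ x) *
        {z : ℝ × ℝ | z.1 ≤ T}.indicator 1 (‖x‖, inner ℝ e x) := by
    intro x
    by_cases hx : ‖x‖ ≤ T <;> simp [truncGenGaussianWeight, indicator, hx]
  have hr : ∀ t, ∫⁻ b, {z : ℝ × ℝ | z.1 ≤ T}.indicator 1
      (rad d k σ t, rad d k σ t * (2 * b - 1)) ∂angleLaw d =
        (Iic (T ^ 2 / (2 * sigma' d k σ ^ 2))).indicator 1 t := by
    intro t
    have h := rad_le_iff hkd hσ hT t
    by_cases ht : t ≤ T ^ 2 / (2 * sigma' d k σ ^ 2)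
    · simp [indicator, ht, h.2 ht]
    · simp [indicator, ht, h]
  simp_rw [hr] at key
  rw [lintegral_indicator_one measurableSet_Iic] at key
  have hnn : ∀ x, 0 ≤ truncGenGaussianWeight d k T σ x := by
    intro x
    unfold truncGenGaussianWeight
    split_ifs
    · exact genGaussianWeight_nonneg d k σ x
    · exact le_rfl
  have hm : Measurable (truncGenGaussianWeight d k T σ) :=
    Measurable.ite (measurableSet_le measurable_norm measurable_const)
      (measurable_genGaussianWeight d k σ) measurable_const
  rw [integral_eq_lintegral_of_nonneg_ae (ae_of_all _ hnn) hm.aestronglyMeasurable]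
  simp_rw [hl]
  rw [key, ENNReal.toReal_mul, ← integral_genGaussianWeight, nu, inv_inv, cdf_eq_real]
  rfl

theorem truncGenGaussianDensity_eq {d k : ℕ} (hk : 1 ≤ k) (hkd : 2 * k < d) {T σ : ℝ}
    (hσ : 0 < σ) (hT : 0 < T) (x : EuclideanSpace ℝ (Fin d)) :
    truncGenGaussianDensity d k T σ x =
      if ‖x‖ ≤ T then nu d k T σ * genGaussianDensity d k σ x else 0 := by
  have hZ := integral_genGaussianWeight_pos hk hkd hσ
  have hν := nu_pos hkd hσ hT
  rw [truncGenGaussianDensity, truncGenGaussianWeight, integral_truncGenGaussianWeight hk hkd hσ hT,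
    genGaussianDensity]
  split_ifs
  · field_simp
  · simp

theorem lawOfDensity_truncGenGaussianDensity {d k : ℕ} (hk : 1 ≤ k) (hkd : 2 * k < d) {T σ : ℝ}
    (hσ : 0 < σ) (hT : 0 < T) {S : Set (EuclideanSpace ℝ (Fin d))} (hS : MeasurableSet S) :
    (lawOfDensity (truncGenGaussianDensity d k T σ)).real S =
      nu d k T σ * (lawOfDensity (genGaussianDensity d k σ)).real (S ∩ {x | ‖x‖ ≤ T}) := by
  have hν := nu_pos hkd hσ hT
  have hball : MeasurableSet {x : EuclideanSpace ℝ (Fin d) | ‖x‖ ≤ T} :=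
    measurableSet_le measurable_norm measurable_const
  have hm : Measurable (genGaussianDensity d k σ) :=
    (measurable_genGaussianWeight d k σ).div_const _
  rw [measureReal_def, measureReal_def, lawOfDensity, lawOfDensity, withDensity_apply _ hS,
    withDensity_apply _ (hS.inter hball), ← ENNReal.toReal_ofReal_mul _ _ hν.le]
  congr 1
  rw [← lintegral_const_mul _ hm.ennreal_ofReal, inter_comm,
    ← setLIntegral_indicator hball]
  refine lintegral_congr fun x => ?_
  rw [truncGenGaussianDensity_eq hk hkd hσ hT]
  by_cases hx : ‖x‖ ≤ T
  · rw [indicator_of_mem (show x ∈ {x : EuclideanSpace ℝ (Fin d) | ‖x‖ ≤ T} from hx), if_pos hx,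
      ENNReal.ofReal_mul hν.le]
  · rw [indicator_of_notMem (show x ∉ {x : EuclideanSpace ℝ (Fin d) | ‖x‖ ≤ T} from hx), if_neg hx,
      ENNReal.ofReal_zero]

/-! ### The Lambert function and the comparison of weights -/

theorem mul_exp_lt_mul_exp_iff {v w : ℝ} (hv : 0 ≤ v) (hw : 0 ≤ w) :
    v * Real.exp v < w * Real.exp w ↔ v < w := by
  have : StrictMonoOn (fun w : ℝ => w * Real.exp w) (Ici 0) := by
    intro a ha b hb hab
    exact mul_lt_mul'' hab (Real.exp_lt_exp.2 hab) ha (Real.exp_pos a).le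
  exact this.lt_iff_lt hv hw

/-- A preimage exists by the intermediate value theorem, as `0 ≤ x ≤ x e^x`. Whichever one is chosen
in `[-1, ∞)` is nonnegative, because `w e^w < 0` for `w < 0`. -/
theorem lambertW_spec {x : ℝ} (hx : 0 < x) :
    0 ≤ lambertW x ∧ lambertW x * Real.exp (lambertW x) = x := by
  have hex : ∃ w ∈ Ici (-1 : ℝ), w * Real.exp w = x := by
    have hc : ContinuousOn (fun w : ℝ => w * Real.exp w) (Icc 0 x) := by fun_prop
    obtain ⟨w, hw, h⟩ := intermediate_value_Icc hx.le hc
      (show x ∈ Icc _ _ from ⟨by simpa using hx.le,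
        le_mul_of_one_le_right hx.le (Real.one_le_exp hx.le)⟩)
    exact ⟨w, by simp only [mem_Ici]; linarith [hw.1], h⟩
  have h : lambertW x * Real.exp (lambertW x) = x := Function.invFunOn_eq hex
  refine ⟨?_, h⟩
  by_contra! hneg
  have := mul_neg_of_neg_of_pos hneg (Real.exp_pos (lambertW x))
  linarith

theorem lt_lambertW_iff {v x : ℝ} (hv : 0 ≤ v) (hx : 0 < x) :
    v < lambertW x ↔ v * Real.exp v < x := by
  obtain ⟨h0, h1⟩ := lambertW_spec hx
  rw [← mul_exp_lt_mul_exp_iff hv h0, h1]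

theorem lambertW_lt_iff {v x : ℝ} (hv : 0 ≤ v) (hx : 0 < x) :
    lambertW x < v ↔ x < v * Real.exp v := by
  obtain ⟨h0, h1⟩ := lambertW_spec hx
  rw [← mul_exp_lt_mul_exp_iff h0 hv, h1]

/-- The factor `k` in the scaling of `s²` turns the exponential into `e^(-kv)`, so that both factors
of the weight become `k`-th powers. -/
theorem radialWeight_sq_eq {d k : ℕ} (hk : 1 ≤ k) {σ s v : ℝ} (hσ' : 0 < sigma' d k σ)
    (hs : s ^ 2 = 2 * sigma' d k σ ^ 2 * k * v) :
    radialWeight d k σ s =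
      ((2 * sigma' d k σ ^ 2 * k) ^ k)⁻¹ * ((v * Real.exp v) ^ k)⁻¹ := by
  have hk' : (0 : ℝ) < k := by exact_mod_cast hk
  have hexp : -s ^ 2 / (2 * sigma' d k σ ^ 2) = -(k * v) := by
    rw [hs]; field_simp
  rw [radialWeight, hexp, pow_mul, hs, Real.exp_neg, Real.exp_nat_mul, mul_pow _ v,
    mul_pow v, mul_inv, mul_inv]
  ring

theorem radialWeight_pos {d k : ℕ} {σ s : ℝ} (hs : 0 < s) : 0 < radialWeight d k σ s := by
  unfold radialWeight; positivity

theorem radialWeight_nonneg (d k : ℕ) (σ s : ℝ) : 0 ≤ radialWeight d k σ s := by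
  have : 0 ≤ s ^ (2 * k) := by rw [pow_mul]; positivity
  unfold radialWeight; positivity

theorem inv_pow_lt_mul_inv_pow_iff {k : ℕ} (hk : 1 ≤ k) {c x y : ℝ} (hc : 0 < c) (hx : 0 < x)
    (hy : 0 < y) : (x ^ k)⁻¹ < c * (y ^ k)⁻¹ ↔ y < x * c ^ (1 / (k : ℝ)) := by
  have hroot : (c ^ (1 / (k : ℝ))) ^ k = c := by
    rw [one_div, Real.rpow_inv_natCast_pow hc.le (by omega)]
  rw [← pow_lt_pow_iff_left₀ hy.le (by positivity) (by omega : k ≠ 0), mul_pow, hroot,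
    ← div_eq_mul_inv, inv_eq_one_div, div_lt_div_iff₀ (by positivity) (by positivity), one_mul,
    mul_comm c]

theorem inv_pow_lt_mul_inv_pow_iff' {k : ℕ} (hk : 1 ≤ k) {c x y : ℝ} (hc : 0 < c) (hx : 0 < x)
    (hy : 0 < y) : (y ^ k)⁻¹ < c * (x ^ k)⁻¹ ↔ x * c ^ (-1 / (k : ℝ)) < y := by
  rw [inv_pow_lt_mul_inv_pow_iff hk hc hy hx, neg_div, Real.rpow_neg hc.le, ← div_eq_mul_inv,
    div_lt_iff₀ (by positivity)]

theorem radialWeight_rad_lt_mul_iff {d k : ℕ} (hk : 1 ≤ k) (hkd : 2 * k < d) {σ t c y : ℝ}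
    (hσ : 0 < σ) (ht : 0 < t) (hc : 0 < c) (hy : 0 < y) :
    radialWeight d k σ (rad d k σ t) < c * radialWeight d k σ y ↔
      y ^ 2 < lambertTerm d k σ t (c ^ (1 / (k : ℝ))) := by
  have hs := sigma'_pos hkd hσ
  have hk' : (0 : ℝ) < k := by exact_mod_cast hk
  have hM : 0 < 2 * sigma' d k σ ^ 2 * k := by positivity
  have hyv : y ^ 2 = 2 * sigma' d k σ ^ 2 * k * (y ^ 2 / (2 * sigma' d k σ ^ 2 * k)) := by
    field_simp
  set v := y ^ 2 / (2 * sigma' d k σ ^ 2 * k) with hv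
  have hvpos : 0 < v := by positivity
  -- At the norm `rad d k σ t` the variable `v` equals `t / k`, the source of `(t/k) e^(t/k)` in
  -- `lambertTerm`.
  rw [radialWeight_sq_eq hk hs hyv, radialWeight_sq_eq hk hs (v := t / k)
    (by rw [rad_sq ht.le]; field_simp), mul_left_comm,
    mul_lt_mul_iff_right₀ (by positivity), inv_pow_lt_mul_inv_pow_iff hk hc (by positivity)
    (by positivity), ← lt_lambertW_iff hvpos.le (by positivity), lambertTerm, hyv,
    mul_lt_mul_iff_right₀ hM]

theorem radialWeight_lt_mul_rad_iff {d k : ℕ} (hk : 1 ≤ k) (hkd : 2 * k < d) {σ t c y : ℝ}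
    (hσ : 0 < σ) (ht : 0 < t) (hc : 0 < c) (hy : 0 < y) :
    radialWeight d k σ y < c * radialWeight d k σ (rad d k σ t) ↔
      lambertTerm d k σ t (c ^ (-1 / (k : ℝ))) < y ^ 2 := by
  have hs := sigma'_pos hkd hσ
  have hk' : (0 : ℝ) < k := by exact_mod_cast hk
  have hM : 0 < 2 * sigma' d k σ ^ 2 * k := by positivity
  have hyv : y ^ 2 = 2 * sigma' d k σ ^ 2 * k * (y ^ 2 / (2 * sigma' d k σ ^ 2 * k)) := by
    field_simp
  set v := y ^ 2 / (2 * sigma' d k σ ^ 2 * k) with hv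
  have hvpos : 0 < v := by positivity
  rw [radialWeight_sq_eq hk hs hyv, radialWeight_sq_eq hk hs (v := t / k)
    (by rw [rad_sq ht.le]; field_simp), mul_left_comm,
    mul_lt_mul_iff_right₀ (by positivity), inv_pow_lt_mul_inv_pow_iff' hk hc (by positivity)
    (by positivity), ← lambertW_lt_iff hvpos.le (by positivity), lambertTerm, hyv,
    mul_lt_mul_iff_right₀ hM]

/-! ### Conditional probabilities given the norm -/

theorem betaCDF_eq_angleLaw_real {d k : ℕ} (hk : 1 ≤ k) (hkd : 2 * k < d) (x : ℝ) :
    betaCDF (((d : ℝ) - 1) / 2) x = (angleLaw d).real (Iic x) := by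
  have := isProbabilityMeasure_angleLaw hk hkd
  exact cdf_eq_real (angleLaw d) x

/-- The interval is empty for `y ≤ x`; this is the origin of the maximum with `0` in `u₂`. -/
theorem angleLaw_real_Ioc {d k : ℕ} (hk : 1 ≤ k) (hkd : 2 * k < d) (x y : ℝ) :
    (angleLaw d).real (Ioc x y) =
      max (betaCDF (((d : ℝ) - 1) / 2) y - betaCDF (((d : ℝ) - 1) / 2) x) 0 := by
  have := isProbabilityMeasure_angleLaw hk hkd
  rw [betaCDF_eq_angleLaw_real hk hkd, betaCDF_eq_angleLaw_real hk hkd]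
  rcases le_total x y with h | h
  · have hsub : Iic x ⊆ Iic y := Iic_subset_Iic.2 h
    rw [max_eq_left (sub_nonneg.2 (measureReal_mono hsub)),
      ← measureReal_sdiff hsub measurableSet_Iic]
    congr 1
    ext z; simp [and_comm]
  · rw [Ioc_eq_empty h.not_gt, measureReal_empty,
      max_eq_right (sub_nonpos.2 (measureReal_mono (Iic_subset_Iic.2 h)))]

instance nullSingletonClass_angleLaw {d : ℕ} : NullSingletonClass (angleLaw d) :=
  nullSingletonClass_betaMeasure

/-- The shifted point lies in the ball exactly when `b ≤ a₂`. There the coefficient is `c` and the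
event is `b ≤ a₁`; beyond `a₂` the coefficient is `l₁` and the event is `b ≤ a₃`, up to endpoints. A
nonpositive coefficient empties its piece. -/
theorem angleLaw_real_section_objective {d k : ℕ} (hk : 1 ≤ k) (hkd : 2 * k < d) {σ T r t : ℝ}
    (hσ : 0 < σ) (hT : 0 < T) (hr : 0 < r) (ht : 0 < t) (l₁ l₂ : ℝ) :
    (angleLaw d).real {b | radialWeight d k σ (rad d k σ t) <
        (if √(rad d k σ t ^ 2 + 2 * r * (rad d k σ t * (2 * b - 1)) + r ^ 2) ≤ T
          then l₁ + nu d k T σ * l₂ else l₁) *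
        radialWeight d k σ (√(rad d k σ t ^ 2 + 2 * r * (rad d k σ t * (2 * b - 1)) + r ^ 2))} =
      u₁ d k T σ r l₁ l₂ t + if 0 < l₁ then u₂ d k T σ r l₁ t else 0 := by
  have := isProbabilityMeasure_angleLaw hk hkd
  have hs := rad_pos hkd hσ ht
  set s := rad d k σ t with hsdef
  set c := l₁ + nu d k T σ * l₂ with hcdef
  have h4 : 0 < 4 * r * s := by positivity
  set M₁ := lambertTerm d k σ t (c ^ (1 / (k : ℝ))) with hM₁
  set M₂ := lambertTerm d k σ t (l₁ ^ (1 / (k : ℝ))) with hM₂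
  set a₁ := min (T ^ 2) M₁ / (4 * r * s) - (s - r) ^ 2 / (4 * r * s) with ha₁
  set a₂ := (T ^ 2 - (s - r) ^ 2) / (4 * r * s) with ha₂
  set a₃ := (M₂ - (s - r) ^ 2) / (4 * r * s) with ha₃
  have ha₁₂ : a₁ ≤ a₂ := by
    rw [ha₁, ha₂, ← sub_div]
    gcongr
    exact min_le_left _ _
  have hset : {b | radialWeight d k σ s <
        (if √(s ^ 2 + 2 * r * (s * (2 * b - 1)) + r ^ 2) ≤ T then c else l₁) *
        radialWeight d k σ (√(s ^ 2 + 2 * r * (s * (2 * b - 1)) + r ^ 2))} =ᵐ[angleLaw d]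
      ((if 0 < c then Iic a₁ else ∅) ∪ (if 0 < l₁ then Ioc a₂ a₃ else ∅) : Set ℝ) := by
    rw [Filter.eventuallyEq_set]
    -- Only `a₁` and `a₃` come from strict inequalities; the condition at `a₂` is weak and needs no
    -- exclusion.
    filter_upwards [ae_betaMeasure_mem_Ioo (half_pred_pos hk hkd), Measure.ae_ne (angleLaw d) a₁,
      Measure.ae_ne (angleLaw d) a₃] with b hb hne₁ hne₃
    have hq : s ^ 2 + 2 * r * (s * (2 * b - 1)) + r ^ 2 = (s - r) ^ 2 + 4 * r * s * b := by ring
    -- Since `b > 0`, the shifted point is not the origin, where `radialWeight` has the default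
    -- value `0` instead of blowing up.
    have hqpos : 0 < (s - r) ^ 2 + 4 * r * s * b := by
      have := mul_pos h4 hb.1
      positivity
    have hρ : 0 < √((s - r) ^ 2 + 4 * r * s * b) := Real.sqrt_pos.2 hqpos
    have hle : ∀ M, (s - r) ^ 2 + 4 * r * s * b ≤ M ↔ b ≤ (M - (s - r) ^ 2) / (4 * r * s) := by
      intro M
      rw [le_div_iff₀ h4]
      constructor <;> intro h <;> linarith
    have hlt : ∀ M, (s - r) ^ 2 + 4 * r * s * b < M ↔ b < (M - (s - r) ^ 2) / (4 * r * s) := by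
      intro M
      rw [lt_div_iff₀ h4]
      constructor <;> intro h <;> linarith
    have hT' : √((s - r) ^ 2 + 4 * r * s * b) ≤ T ↔ b ≤ a₂ := by
      rw [Real.sqrt_le_left hT.le, hle]
    have hw := radialWeight_pos (d := d) (k := k) (σ := σ) hs
    have hw' := radialWeight_pos (d := d) (k := k) (σ := σ) hρ
    have hcmp : ∀ l, 0 < l → (radialWeight d k σ s < l * radialWeight d k σ
        (√((s - r) ^ 2 + 4 * r * s * b)) ↔ (s - r) ^ 2 + 4 * r * s * b <
          lambertTerm d k σ t (l ^ (1 / (k : ℝ)))) := by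
      intro l hl
      rw [hsdef, radialWeight_rad_lt_mul_iff hk hkd hσ ht hl hρ, Real.sq_sqrt hqpos.le]
    have hno : ∀ l, ¬ 0 < l → ¬ radialWeight d k σ s < l * radialWeight d k σ
        (√((s - r) ^ 2 + 4 * r * s * b)) := by
      intro l hl
      have := mul_nonpos_of_nonpos_of_nonneg (not_lt.1 hl) hw'.le
      linarith
    simp only [hq, hT', mem_union]
    have h₁ : b ≤ a₁ ↔ b ≤ a₂ ∧ (s - r) ^ 2 + 4 * r * s * b < M₁ := by
      rw [ha₂, ← hle]
      have hmin : b < a₁ ↔ (s - r) ^ 2 + 4 * r * s * b < min (T ^ 2) M₁ := by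
        rw [hlt, sub_div]
      have hmin' : b ≤ a₁ ↔ (s - r) ^ 2 + 4 * r * s * b ≤ min (T ^ 2) M₁ := by
        rw [hle, sub_div]
      constructor
      · intro h
        have := lt_min_iff.1 (hmin.1 (lt_of_le_of_ne h hne₁))
        exact ⟨this.1.le, this.2⟩
      · intro h
        exact hmin'.2 (le_min h.1 h.2.le)
    have h₃ : b ≤ a₃ ↔ (s - r) ^ 2 + 4 * r * s * b < M₂ := by
      rw [hlt]
      exact ⟨fun h => lt_of_le_of_ne h hne₃, le_of_lt⟩
    by_cases hba : b ≤ a₂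
    · have hb2 : b ∉ (if 0 < l₁ then Ioc a₂ a₃ else ∅ : Set ℝ) := by
        split_ifs
        · exact fun h => not_lt.2 hba h.1
        · exact notMem_empty b
      simp only [hba, if_true, hb2, or_false]
      by_cases hc : 0 < c
      · rw [if_pos hc, hcmp c hc, mem_Iic, h₁]
        exact (and_iff_right hba).symm
      · rw [if_neg hc]
        exact iff_of_false (hno c hc) (notMem_empty b)
    · have hb1 : b ∉ (if 0 < c then Iic a₁ else ∅ : Set ℝ) := by
        split_ifs
        · exact fun h => hba (le_trans h ha₁₂)
        · exact notMem_empty b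
      simp only [hba, if_false, hb1, false_or]
      by_cases hl : 0 < l₁
      · rw [if_pos hl, hcmp l₁ hl, mem_Ioc, h₃]
        exact (and_iff_right (not_le.1 hba)).symm
      · rw [if_neg hl]
        exact iff_of_false (hno l₁ hl) (notMem_empty b)
  rw [measureReal_congr hset, measureReal_union]
  · congr 1
    · rw [u₁]
      split_ifs
      · rw [← betaCDF_eq_angleLaw_real hk hkd]
      · exact measureReal_empty
    · split_ifs
      · rw [angleLaw_real_Ioc hk hkd, u₂]
      · exact measureReal_empty
  · split_ifs
    · exact Iic_disjoint_Ioc ha₁₂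
    all_goals simp
  · split_ifs
    · exact measurableSet_Ioc
    · exact MeasurableSet.empty

/-- The squared norm of `x - δ` decreases in `b`, so a lower bound on it is an upper bound on `b`.
The coefficient `l` is constant because truncation sees only `‖x‖`. -/
theorem angleLaw_real_section_constraint {d k : ℕ} (hk : 1 ≤ k) (hkd : 2 * k < d) {σ r t : ℝ}
    (hσ : 0 < σ) (hr : 0 < r) (ht : 0 < t) (l : ℝ) :
    (angleLaw d).real {b | radialWeight d k σ
        (√(rad d k σ t ^ 2 - 2 * r * (rad d k σ t * (2 * b - 1)) + r ^ 2)) <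
          l * radialWeight d k σ (rad d k σ t)} = u₃ d k σ r t l := by
  have := isProbabilityMeasure_angleLaw hk hkd
  have hs := rad_pos hkd hσ ht
  set s := rad d k σ t with hsdef
  have h4 : 0 < 4 * r * s := by positivity
  rw [u₃]
  split_ifs with hl
  · set M := lambertTerm d k σ t (l ^ (-1 / (k : ℝ))) with hM
    set a := (r + s) ^ 2 / (4 * r * s) - M / (4 * r * s) with ha
    rw [betaCDF_eq_angleLaw_real hk hkd]
    refine measureReal_congr (Filter.eventuallyEq_set.2 ?_)
    filter_upwards [ae_betaMeasure_mem_Ioo (half_pred_pos hk hkd),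
      Measure.ae_ne (angleLaw d) a] with b hb hne
    have hq : s ^ 2 - 2 * r * (s * (2 * b - 1)) + r ^ 2 =
        (s - r) ^ 2 + 4 * r * s * (1 - b) := by ring
    have hqpos : 0 < (s - r) ^ 2 + 4 * r * s * (1 - b) := by
      have := mul_pos h4 (sub_pos.2 hb.2)
      positivity
    rw [hq, hsdef, radialWeight_lt_mul_rad_iff hk hkd hσ ht hl
      (Real.sqrt_pos.2 hqpos), Real.sq_sqrt hqpos.le, mem_Iic]
    have hiff : M < (s - r) ^ 2 + 4 * r * s * (1 - b) ↔ b < a := by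
      rw [ha, ← sub_div, lt_div_iff₀ h4]
      constructor <;> intro h <;> linarith
    rw [hiff]
    exact ⟨le_of_lt, fun h => lt_of_le_of_ne h hne⟩
  · convert measureReal_empty (μ := angleLaw d)
    ext b
    simp only [mem_ofPred_eq, mem_empty_iff_false, iff_false, not_lt]
    exact (mul_nonpos_of_nonpos_of_nonneg (not_lt.1 hl) (radialWeight_nonneg d k σ s)).trans
      (radialWeight_nonneg d k σ _)

/-! ### The events of the dual problem -/

theorem norm_add_smul_unit {d : ℕ} {e x : EuclideanSpace ℝ (Fin d)} (he : ‖e‖ = 1) (r : ℝ) :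
    ‖x + r • e‖ = √(‖x‖ ^ 2 + 2 * r * inner ℝ e x + r ^ 2) := by
  rw [← Real.sqrt_sq (norm_nonneg (x + r • e)), norm_add_sq_real, norm_smul, he,
    inner_smul_right, real_inner_comm, mul_one, Real.norm_eq_abs, sq_abs]
  congr 2; ring

theorem norm_sub_smul_unit {d : ℕ} {e x : EuclideanSpace ℝ (Fin d)} (he : ‖e‖ = 1) (r : ℝ) :
    ‖x - r • e‖ = √(‖x‖ ^ 2 - 2 * r * inner ℝ e x + r ^ 2) := by
  rw [sub_eq_add_neg, ← neg_smul, norm_add_smul_unit he]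
  congr 1; ring

/-- The mixture is a piecewise constant multiple of `p`, so the normalizing constant cancels. -/
theorem genGaussianDensity_lt_add_iff {d k : ℕ} (hk : 1 ≤ k) (hkd : 2 * k < d) {T σ : ℝ}
    (hσ : 0 < σ) (hT : 0 < T) (l₁ l₂ : ℝ) (x y : EuclideanSpace ℝ (Fin d)) :
    genGaussianDensity d k σ x <
        l₁ * genGaussianDensity d k σ y + l₂ * truncGenGaussianDensity d k T σ y ↔
      radialWeight d k σ ‖x‖ <
        (if ‖y‖ ≤ T then l₁ + nu d k T σ * l₂ else l₁) * radialWeight d k σ ‖y‖ := by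
  have hZ := integral_genGaussianWeight_pos hk hkd hσ
  have hcomb : l₁ * genGaussianDensity d k σ y + l₂ * truncGenGaussianDensity d k T σ y =
      (if ‖y‖ ≤ T then l₁ + nu d k T σ * l₂ else l₁) * genGaussianDensity d k σ y := by
    rw [truncGenGaussianDensity_eq hk hkd hσ hT]
    split_ifs <;> ring
  rw [hcomb, genGaussianDensity, genGaussianDensity, ← mul_div_assoc,
    div_lt_div_iff_of_pos_right hZ, genGaussianWeight_eq_radialWeight,
    genGaussianWeight_eq_radialWeight]

theorem ae_gammaLaw_pos (d k : ℕ) : ∀ᵐ t ∂gammaLaw d k, 0 < t := ae_gammaMeasure_pos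

theorem R_eq_integral {d k : ℕ} (hk : 1 ≤ k) (hkd : 2 * k < d) {σ T r : ℝ} (hσ : 0 < σ)
    (hT : 0 < T) (hr : 0 < r) {e : EuclideanSpace ℝ (Fin d)} (he : ‖e‖ = 1) (l₁ l₂ : ℝ) :
    Integrable (fun t => u₁ d k T σ r l₁ l₂ t + if 0 < l₁ then u₂ d k T σ r l₁ t else 0)
        (gammaLaw d k) ∧
      R d k T σ (r • e) l₁ l₂ =
        ∫ t, (u₁ d k T σ r l₁ l₂ t + if 0 < l₁ then u₂ d k T σ r l₁ t else 0)
          ∂gammaLaw d k := by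
  have hm := measurable_radialWeight d k σ
  have hA : MeasurableSet {z : ℝ × ℝ | radialWeight d k σ z.1 <
      (if √(z.1 ^ 2 + 2 * r * z.2 + r ^ 2) ≤ T then l₁ + nu d k T σ * l₂ else l₁) *
        radialWeight d k σ (√(z.1 ^ 2 + 2 * r * z.2 + r ^ 2))} := by
    refine measurableSet_lt (by fun_prop) (Measurable.mul ?_ (by fun_prop))
    exact Measurable.ite (measurableSet_le (by fun_prop) measurable_const) measurable_const
      measurable_const
  have key := integrable_and_lawOfDensity_real_eq_integral hk hkd hσ he hA
    (u := fun t => u₁ d k T σ r l₁ l₂ t + if 0 < l₁ then u₂ d k T σ r l₁ t else 0) (by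
      filter_upwards [ae_gammaLaw_pos d k] with t ht
      exact angleLaw_real_section_objective hk hkd hσ hT hr ht l₁ l₂)
  refine ⟨key.1, ?_⟩
  rw [← key.2, R, dualObjective]
  congr 1
  ext x
  rw [mem_ofPred_eq, genGaussianDensity_lt_add_iff hk hkd hσ hT, norm_add_smul_unit he]
  rfl

theorem measurableSet_constraint (d k : ℕ) (T σ r l₁ c : ℝ) :
    MeasurableSet {z : ℝ × ℝ | radialWeight d k σ (√(z.1 ^ 2 - 2 * r * z.2 + r ^ 2)) <
      (if z.1 ≤ T then c else l₁) * radialWeight d k σ z.1} := by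
  have hm := measurable_radialWeight d k σ
  refine measurableSet_lt (by fun_prop) (Measurable.mul ?_ (by fun_prop))
  exact Measurable.ite (measurableSet_le (by fun_prop) measurable_const) measurable_const
    measurable_const

theorem setOf_constraint_eq {d k : ℕ} (hk : 1 ≤ k) (hkd : 2 * k < d) {σ T : ℝ} (hσ : 0 < σ)
    (hT : 0 < T) (r : ℝ) {e : EuclideanSpace ℝ (Fin d)} (he : ‖e‖ = 1) (l₁ l₂ : ℝ) :
    {x | genGaussianDensity d k σ (x - r • e) <
        l₁ * genGaussianDensity d k σ x + l₂ * truncGenGaussianDensity d k T σ x} =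
      {x | (‖x‖, inner ℝ e x) ∈ {z : ℝ × ℝ |
        radialWeight d k σ (√(z.1 ^ 2 - 2 * r * z.2 + r ^ 2)) <
          (if z.1 ≤ T then l₁ + nu d k T σ * l₂ else l₁) * radialWeight d k σ z.1}} := by
  ext x
  rw [mem_ofPred_eq, genGaussianDensity_lt_add_iff hk hkd hσ hT, norm_sub_smul_unit he]
  rfl

theorem P_eq_integral {d k : ℕ} (hk : 1 ≤ k) (hkd : 2 * k < d) {σ T r : ℝ} (hσ : 0 < σ)
    (hT : 0 < T) (hr : 0 < r) {e : EuclideanSpace ℝ (Fin d)} (he : ‖e‖ = 1) (l₁ l₂ : ℝ) :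
    Integrable (fun t => integrandP d k T σ r l₁ l₂ t) (gammaLaw d k) ∧
      P d k T σ (r • e) l₁ l₂ = ∫ t, integrandP d k T σ r l₁ l₂ t ∂gammaLaw d k := by
  have : NullSingletonClass (gammaLaw d k) := nullSingletonClass_gammaMeasure
  have hsec : ∀ᵐ t ∂gammaLaw d k, (angleLaw d).real {b | radialWeight d k σ
      (√(rad d k σ t ^ 2 - 2 * r * (rad d k σ t * (2 * b - 1)) + r ^ 2)) <
        (if rad d k σ t ≤ T then l₁ + nu d k T σ * l₂ else l₁) *
          radialWeight d k σ (rad d k σ t)} = integrandP d k T σ r l₁ l₂ t := by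
    -- At `t = T² / (2σ'²)` the closed ball and `integrandP` choose different branches, so this null
    -- point is removed.
    filter_upwards [ae_gammaLaw_pos d k,
      Measure.ae_ne (gammaLaw d k) (T ^ 2 / (2 * sigma' d k σ ^ 2))] with t ht hne
    have hiff := rad_le_iff hkd hσ hT t
    rw [angleLaw_real_section_constraint hk hkd hσ hr ht, integrandP]
    by_cases h : t ≤ T ^ 2 / (2 * sigma' d k σ ^ 2)
    · rw [if_pos (hiff.2 h), if_neg (not_le.2 (lt_of_le_of_ne h hne))]
    · rw [if_neg (mt hiff.1 h), if_pos (not_le.1 h).le]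
  have key := integrable_and_lawOfDensity_real_eq_integral hk hkd hσ he
    (measurableSet_constraint d k T σ r l₁ (l₁ + nu d k T σ * l₂)) hsec
  refine ⟨key.1, ?_⟩
  rw [← key.2, P, dualConstraint, setOf_constraint_eq hk hkd hσ hT r he]

theorem Q_eq_integral {d k : ℕ} (hk : 1 ≤ k) (hkd : 2 * k < d) {σ T r : ℝ} (hσ : 0 < σ)
    (hT : 0 < T) (hr : 0 < r) {e : EuclideanSpace ℝ (Fin d)} (he : ‖e‖ = 1) (l₁ l₂ : ℝ) :
    Integrable (fun t => integrandQ d k T σ r l₁ l₂ t) (gammaLaw d k) ∧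
      Q d k T σ (r • e) l₁ l₂ =
        nu d k T σ * ∫ t, integrandQ d k T σ r l₁ l₂ t ∂gammaLaw d k := by
  have hA := measurableSet_constraint d k T σ r l₁ (l₁ + nu d k T σ * l₂)
  have hS : MeasurableSet {z : ℝ × ℝ | z.1 ≤ T} := measurableSet_le measurable_fst measurable_const
  have hmap : Measurable fun x : EuclideanSpace ℝ (Fin d) => (‖x‖, inner ℝ e x) := by fun_prop
  -- The law of `q` is `ν` times that of `p` on the ball, so the event is intersected with it. Here
  -- the boundary conventions agree.
  have key := integrable_and_lawOfDensity_real_eq_integral hk hkd hσ he (hA.inter hS)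
    (u := fun t => integrandQ d k T σ r l₁ l₂ t) (by
      filter_upwards [ae_gammaLaw_pos d k] with t ht
      have hiff := rad_le_iff hkd hσ hT t
      simp only [mem_inter_iff, mem_ofPred_eq]
      rw [integrandQ]
      by_cases h : t ≤ T ^ 2 / (2 * sigma' d k σ ^ 2)
      · rw [if_pos h, ← angleLaw_real_section_constraint hk hkd hσ hr ht]
        simp only [hiff.2 h, if_true, and_true]
      · rw [if_neg h]
        simp only [mt hiff.1 h, and_false]
        exact measureReal_empty)
  refine ⟨key.1, ?_⟩
  rw [← key.2, Q, dualConstraint, setOf_constraint_eq hk hkd hσ hT r he,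
    lawOfDensity_truncGenGaussianDensity hk hkd hσ hT (S := {x | (‖x‖, inner ℝ e x) ∈ _}) (hmap hA)]
  rfl

end DSRS

theorem theorem5 (d k : ℕ) (hk : 1 ≤ k) (hkd : 2 * k < d) (σ T : ℝ) (hσ : 0 < σ) (hT : 0 < T)
    (δ : EuclideanSpace ℝ (Fin d)) (hδ : δ ≠ 0) (r : ℝ) (hr : r = ‖δ‖) (l₁ l₂ : ℝ) :
    (l₁ ≤ 0 →
      Integrable (fun t => DSRS.u₁ d k T σ r l₁ l₂ t) (DSRS.gammaLaw d k) ∧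
      DSRS.R d k T σ δ l₁ l₂ = ∫ t, DSRS.u₁ d k T σ r l₁ l₂ t ∂(DSRS.gammaLaw d k)) ∧
    (0 < l₁ →
      Integrable (fun t => DSRS.u₁ d k T σ r l₁ l₂ t + DSRS.u₂ d k T σ r l₁ t)
        (DSRS.gammaLaw d k) ∧
      DSRS.R d k T σ δ l₁ l₂ =
        ∫ t, (DSRS.u₁ d k T σ r l₁ l₂ t + DSRS.u₂ d k T σ r l₁ t) ∂(DSRS.gammaLaw d k)) ∧
    (Integrable (fun t => DSRS.integrandP d k T σ r l₁ l₂ t) (DSRS.gammaLaw d k) ∧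
      DSRS.P d k T σ δ l₁ l₂ =
        ∫ t, DSRS.integrandP d k T σ r l₁ l₂ t ∂(DSRS.gammaLaw d k)) ∧
    (Integrable (fun t => DSRS.integrandQ d k T σ r l₁ l₂ t) (DSRS.gammaLaw d k) ∧
      DSRS.Q d k T σ δ l₁ l₂ =
        DSRS.nu d k T σ * ∫ t, DSRS.integrandQ d k T σ r l₁ l₂ t ∂(DSRS.gammaLaw d k)) := by
  have hrpos : 0 < r := hr ▸ norm_pos_iff.2 hδ
  obtain ⟨e, he, rfl⟩ : ∃ e : EuclideanSpace ℝ (Fin d), ‖e‖ = 1 ∧ δ = r • e := by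
    refine ⟨r⁻¹ • δ, ?_, ?_⟩
    · rw [norm_smul, norm_inv, Real.norm_of_nonneg hrpos.le, ← hr, inv_mul_cancel₀ hrpos.ne']
    · rw [smul_inv_smul₀ hrpos.ne']
  have hR := DSRS.R_eq_integral hk hkd hσ hT hrpos he l₁ l₂
  refine ⟨fun hl => ?_, fun hl => ?_, DSRS.P_eq_integral hk hkd hσ hT hrpos he l₁ l₂,
    DSRS.Q_eq_integral hk hkd hσ hT hrpos he l₁ l₂⟩
  · simpa only [if_neg (not_lt.2 hl), add_zero] using hR
  · simpa only [if_pos hl] using hR
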